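/- Let $(W_t)_{t\ge 0}$ be a standard Brownian motion on a probability space $(\Omega,\mathcal F,\mathbb P)$, and let $\eta,\sigma>0$, $M\ge 0$, $x\in[-M,M]$, $q\in(0,1)$. A deterministic schedule is a Borel function $\pi:[0,\infty)\to\mathbb R$ with $\int_0^\infty \pi_t^2\,dt<\infty$ whose position $X_t^{x,\pi}=x-\int_0^t\pi_s\,ds$ satisfies $\int_0^\infty |X_t^{x,\pi}|^2\,dt<\infty$ and $X_t^{x,\pi}\in[-M,M]$ for all $t\ge0$; let $\mathcal D(x)$ be the set of deterministic schedules. The total cost of $\pi\in\mathcal D(x)$ is the limit in $L^2(\mathbb P)$, as $t\to\infty$, $$C_\infty^{x,\pi}=\lim_{t\to\infty}\Big(\int_0^t\tfrac12\eta\,\pi_s^2\,ds-\int_0^t\sigma X_s^{x,\pi}\,dW_s\Big).$$ For $C\in L^1$ put $$\mathrm{CVaR}_q[C]=\sup\{\mathbb E[CQ]: 0\le Q\le 1/q \text{ a.s.},\ \mathbb E Q=1\},\qquad \text{S-CVaR}_q[C]=\sup\{\mathbb E[CQ]: 0\le Q\le 1\text{ a.s.},\ \mathbb E Q=q\}.$$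 Let $\phi$ and $\Phi$ be the density and the distribution function of the standard normal distribution, $\kappa(q)=\phi(\Phi^{-1}(1-q))$, and $$\tau^\star=\left(\frac{\eta\,|x|\,q}{\sqrt2\,\sigma\,\kappa(q)}\right)^{2/3}.$$ **Proposition (Optimized deterministic schedule).** The total cost $C_\infty^{x,\pi}$ exists and is almost surely unique for every $\pi\in\mathcal D(x)$. The exponential schedule $X_t=x\,e^{-t/\tau^\star}$ (read as $X_t\equiv0$ if $x=0$), that is, the rate $\pi_t=(x/\tau^\star)e^{-t/\tau^\star}$, belongs to $\mathcal D(x)$ and minimizes $\mathrm{CVaR}_q[C_\infty^{x,\pi}]$, and equivalently $\text{S-CVaR}_q[C_\infty^{x,\pi}]$, over $\pi\in\mathcal D(x)$. It is the only optimal one: every minimizer $\pi\in\mathcal D(x)$ has the position $X_t^{x,\pi}=x\,e^{-t/\tau^\star}$ for all $t\ge0$. The optimal value is $$\text{S-CVaR}_q\big[C_\infty^{x,\mathrm{exp}}\big]=\frac{3}{2^{5/3}}\,\sigma^{2/3}\,\eta^{1/3}\,|x|^{4/3}\,q^{1/3}\,\kappa(q)^{2/3}.$$ -/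

import Mathlib

open MeasureTheory ProbabilityTheory Filter Topology
open scoped NNReal ENNReal

noncomputable section

namespace OptimalExecution

/-! ### The standard normal distribution -/

/-- The quantile function `Φ⁻¹(p) = inf {z | p ≤ Φ z}` of the standard normal distribution. -/
def normalQuantile (p : ℝ) : ℝ := sInf {z : ℝ | p ≤ cdf (gaussianReal 0 1) z}

/-- `κ(q) = φ(Φ⁻¹(1 - q))`. -/
def kappa (q : ℝ) : ℝ := gaussianPDFReal 0 1 (normalQuantile (1 - q))

/-! ### Conditional value-at-risk and its scaled version, through their dual representations -/

variable {Ω : Type*} [MeasurableSpace Ω]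

/-- The random variables `Q` with `0 ≤ Q ≤ 1/q` almost surely and `E Q = 1`. -/
def cvarEnvelope (P : Measure Ω) (q : ℝ) : Set (Ω → ℝ) :=
  {Q | AEStronglyMeasurable Q P ∧ (∀ᵐ ω ∂P, 0 ≤ Q ω ∧ Q ω ≤ 1 / q) ∧ ∫ ω, Q ω ∂P = 1}

/-- The random variables `Q` with `0 ≤ Q ≤ 1` almost surely and `E Q = q`. -/
def scvarEnvelope (P : Measure Ω) (q : ℝ) : Set (Ω → ℝ) :=
  {Q | AEStronglyMeasurable Q P ∧ (∀ᵐ ω ∂P, 0 ≤ Q ω ∧ Q ω ≤ 1) ∧ ∫ ω, Q ω ∂P = q}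

/-- `CVaR_q[C] = sup E[C Q]` over the CVaR envelope, for integrable `C` and `0 < q ≤ 1`. -/
def cvar (P : Measure Ω) (q : ℝ) (C : Ω → ℝ) : ℝ :=
  sSup ((fun Q : Ω → ℝ => ∫ ω, C ω * Q ω ∂P) '' cvarEnvelope P q)

/-- `S-CVaR_q[C] = sup E[C Q]` over the scaled envelope, for integrable `C` and `0 ≤ q ≤ 1`. -/
def scvar (P : Measure Ω) (q : ℝ) (C : Ω → ℝ) : ℝ :=
  sSup ((fun Q : Ω → ℝ => ∫ ω, C ω * Q ω ∂P) '' scvarEnvelope P q)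

/-! ### The stochastic integral of a deterministic integrand -/

/-- A step function `∑ i, c i • 1_(a i, b i]` on `[0, ∞)`, with bounded intervals (they may
overlap). -/
structure StepFunction where
  /-- the number of intervals -/
  n : ℕ
  /-- the coefficients -/
  c : Fin n → ℝ
  /-- the left end points -/
  a : Fin n → ℝ≥0
  /-- the right end points -/
  b : Fin n → ℝ≥0
  le : ∀ i, a i ≤ b i

/-- The value of a step function at time `t`. -/
def StepFunction.eval (h : StepFunction) (t : ℝ) : ℝ :=
  ∑ i, (Set.Ioc (h.a i : ℝ) (h.b i : ℝ)).indicator (fun _ => h.c i) t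

/-- The elementary integral `∫ h dW = ∑ i, c i * (W (b i) - W (a i))` of a step function. -/
def StepFunction.stochIntegral (h : StepFunction) (W : ℝ≥0 → Ω → ℝ) (ω : Ω) : ℝ :=
  ∑ i, h.c i * (W (h.b i) ω - W (h.a i) ω)

/-- `I` is (a version of) the stochastic integral `∫_0^∞ f(s) dW_s` of the deterministic
square-integrable function `f`: it is the limit in `L²(P)` of the elementary integrals of some step
functions that converge to `f` in `L²([0, ∞))`. -/
def HasStochIntegral (P : Measure Ω) (W : ℝ≥0 → Ω → ℝ) (f : ℝ → ℝ) (I : Ω → ℝ) : Prop :=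
  MemLp f 2 (volume.restrict (Set.Ici 0)) ∧ MemLp I 2 P ∧
    ∃ h : ℕ → StepFunction,
      Tendsto (fun n => eLpNorm (fun t => f t - (h n).eval t) 2 (volume.restrict (Set.Ici 0)))
        atTop (𝓝 0) ∧
      Tendsto (fun n => eLpNorm (fun ω => I ω - (h n).stochIntegral W ω) 2 P) atTop (𝓝 0)

/-! ### The liquidation model, for deterministic policies -/

/-- The position `X_t = x - ∫_0^t π_s ds` under the liquidation rate `π`. -/
def position (x : ℝ) (π : ℝ → ℝ) (t : ℝ) : ℝ := x - ∫ s in (0 : ℝ)..t, π s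

/-- The admissible deterministic policies from the initial position `x`, when positions are confined
to `[-M, M]`. A policy is a function of `t ∈ [0, ∞)`; its values at negative times play no role. -/
structure IsDeterministicPolicy (M x : ℝ) (π : ℝ → ℝ) : Prop where
  measurable : Measurable fun t : Set.Ici (0 : ℝ) => π t
  rate_sq_integrable : IntegrableOn (fun t => π t ^ 2) (Set.Ici 0)
  position_sq_integrable : IntegrableOn (fun t => position x π t ^ 2) (Set.Ici 0)
  position_mem : ∀ t, 0 ≤ t → position x π t ∈ Set.Icc (-M) M

/-- The set of all admissible deterministic policies. -/
def deterministicPolicies (M x : ℝ) : Set (ℝ → ℝ) := {π | IsDeterministicPolicy M x π}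

/-- `C` is (a version of) the cost process
`C_t = ∫_0^t (1/2) η π_s² ds - ∫_0^t σ X_s dW_s`. -/
def IsCostProcess (P : Measure Ω) (W : ℝ≥0 → Ω → ℝ) (η σ x : ℝ) (π : ℝ → ℝ)
    (C : ℝ≥0 → Ω → ℝ) : Prop :=
  ∀ t : ℝ≥0, ∃ I : Ω → ℝ,
    HasStochIntegral P W ((Set.Ioc 0 (t : ℝ)).indicator fun s => σ * position x π s) I ∧
    ∀ᵐ ω ∂P, C t ω = (∫ s in (0 : ℝ)..t, 1 / 2 * η * π s ^ 2) - I ω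

/-- `Cinf` is (a version of) the total cost `C_∞`, the limit in `L²(P)` of `C_t` as `t → ∞`. -/
def IsTotalCost (P : Measure Ω) (W : ℝ≥0 → Ω → ℝ) (η σ x : ℝ) (π : ℝ → ℝ)
    (Cinf : Ω → ℝ) : Prop :=
  MemLp Cinf 2 P ∧ ∃ C : ℝ≥0 → Ω → ℝ, IsCostProcess P W η σ x π C ∧
    Tendsto (fun t => eLpNorm (fun ω => C t ω - Cinf ω) 2 P) atTop (𝓝 0)

open Classical in
/-- The total cost `C_∞` of the policy `π` (zero if the limit that defines it does not exist). -/
def totalCost (P : Measure Ω) (W : ℝ≥0 → Ω → ℝ) (η σ x : ℝ) (π : ℝ → ℝ) : Ω → ℝ :=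
  if h : ∃ C, IsTotalCost P W η σ x π C then h.choose else 0

/-- The liquidation rate `(x / τ) e^{-t/τ}`, under which the position is `x e^{-t/τ}`. -/
def expPolicy (x τ : ℝ) (t : ℝ) : ℝ := x / τ * Real.exp (-t / τ)

/-- `τ* = (η |x| q / (√2 σ κ(q)))^(2/3)`. -/
def tauStar (η σ x q : ℝ) : ℝ := (η * |x| * q / (√2 * σ * kappa q)) ^ (2 / 3 : ℝ)

end OptimalExecution

end

open OptimalExecution

/-! The integrand of the stochastic term is deterministic, so the total cost is normal. Elementary
integrals of step functions are centered Gaussian with variance `∫ h²`; density, completeness and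
passage to the limit in law carry this to all of `L²`. With `A = ∫ π²` and `B = ∫ X²`, the cost has
mean `η A / 2` and variance `σ² B` (`map_totalCost`).

For a law `N(m, s²)` the scaled CVaR is `q m + s κ(q)`, attained by the indicator of the upper tail
of mass `q` (`scvar_eq_of_hasLaw`). It remains to minimize `α A + β √B` with `α = q η / 2` and `β =
σ κ(q)`.

Since `X' = -π` a.e. and `X² → 0`, one has `∫ X π = x² / 2`, so Cauchy–Schwarz gives `x⁴ ≤ 4 A B`,
with equality (for `x ≠ 0`) only if `π = r X` a.e. for a constant `r`. Under this constraint the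
problem is the one-variable minimization of `α x⁴ / (4 b²) + β b` over `b = √B > 0`, whose unique
critical point has `β b³ = α x⁴ / 2` (`min_energy`). There `∫ (π - X / τ*)² = 0`, and the resulting
linear equation `X' = -X / τ*` forces the exponential. -/

namespace OptimalExecution

variable {Ω : Type*} [MeasurableSpace Ω]

/-! ### Step functions -/

namespace StepFunction

/-- The difference of two step functions. -/
def sub (h k : StepFunction) : StepFunction where
  n := h.n + k.n
  c := Fin.append h.c (fun i => -k.c i)
  a := Fin.append h.a k.a
  b := Fin.append h.b k.b
  le i := by
    refine Fin.addCases (fun i => ?_) (fun i => ?_) i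
    · simpa using h.le i
    · simpa using k.le i

lemma eval_sub (h k : StepFunction) (t : ℝ) : (h.sub k).eval t = h.eval t - k.eval t := by
  have key : ∀ (s : Set ℝ) (c : ℝ), s.indicator (fun _ => -c) t = -s.indicator (fun _ => c) t :=
    fun s c => by by_cases hs : t ∈ s <;> simp [hs]
  have h1 : (h.sub k).eval t = ∑ i : Fin (h.n + k.n),
      (Set.Ioc ((Fin.append h.a k.a i : ℝ≥0) : ℝ) ((Fin.append h.b k.b i : ℝ≥0) : ℝ)).indicator
        (fun _ => Fin.append h.c (fun i => -k.c i) i) t := rfl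
  rw [h1, Fin.sum_univ_add]
  simp [eval, key, sub_eq_add_neg]

lemma stochIntegral_sub {Ω' : Type*} (h k : StepFunction) (W : ℝ≥0 → Ω' → ℝ) (ω : Ω') :
    (h.sub k).stochIntegral W ω = h.stochIntegral W ω - k.stochIntegral W ω := by
  have h1 : (h.sub k).stochIntegral W ω = ∑ i : Fin (h.n + k.n),
      Fin.append h.c (fun i => -k.c i) i *
        (W (Fin.append h.b k.b i) ω - W (Fin.append h.a k.a i) ω) := rfl
  rw [h1, Fin.sum_univ_add]
  simp [stochIntegral, sub_eq_add_neg]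

lemma memLp_indicator (h : StepFunction) (i : Fin h.n) :
    MemLp ((Set.Ioc (h.a i : ℝ) (h.b i : ℝ)).indicator fun _ => h.c i) 2
      (volume.restrict (Set.Ici 0)) :=
  memLp_indicator_const _ measurableSet_Ioc _ (Or.inr (by
    refine ((Measure.restrict_apply_le _ _).trans_lt ?_).ne
    simp))

lemma memLp_eval (h : StepFunction) : MemLp h.eval 2 (volume.restrict (Set.Ici 0)) :=
  memLp_finsetSum' (f := fun i => (Set.Ioc (h.a i : ℝ) (h.b i : ℝ)).indicator fun _ => h.c i)
    Finset.univ (fun i _ => h.memLp_indicator i) |>.congr_norm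
    (by
      have : h.eval = ∑ i, (Set.Ioc (h.a i : ℝ) (h.b i : ℝ)).indicator fun _ => h.c i := by
        ext t; simp [eval]
      rw [this]
      exact (memLp_finsetSum' Finset.univ (fun i _ => h.memLp_indicator i)).1)
    (Eventually.of_forall fun t => by simp [eval])

/-- Overlap lengths are written through minima so that each term matches the covariance of two
Brownian increments, where `Cov(W_s, W_t) = min s t`. -/
lemma integral_eval_sq (h : StepFunction) :
    ∫ t in Set.Ici (0 : ℝ), h.eval t ^ 2
      = ∑ i, ∑ j, h.c i * h.c j *
        ((min (h.b i) (h.b j) : ℝ≥0) - (min (h.b i) (h.a j) : ℝ≥0)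
          - (min (h.a i) (h.b j) : ℝ≥0) + (min (h.a i) (h.a j) : ℝ≥0) : ℝ) := by
  have h1 : ∀ t, h.eval t ^ 2 = ∑ i, ∑ j,
      (Set.Ioc (h.a i : ℝ) (h.b i : ℝ)).indicator (fun _ => h.c i) t *
        (Set.Ioc (h.a j : ℝ) (h.b j : ℝ)).indicator (fun _ => h.c j) t := fun t => by
    rw [sq, eval, Finset.sum_mul_sum]
  have hint : ∀ i j, Integrable (fun t =>
      (Set.Ioc (h.a i : ℝ) (h.b i : ℝ)).indicator (fun _ => h.c i) t *
        (Set.Ioc (h.a j : ℝ) (h.b j : ℝ)).indicator (fun _ => h.c j) t)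
      (volume.restrict (Set.Ici 0)) := fun i j =>
    (h.memLp_indicator i).integrable_mul (h.memLp_indicator j)
  simp_rw [h1]
  rw [integral_finsetSum _ fun i _ => integrable_finsetSum _ fun j _ => hint i j]
  refine Finset.sum_congr rfl fun i _ => ?_
  rw [integral_finsetSum _ fun j _ => hint i j]
  refine Finset.sum_congr rfl fun j _ => ?_
  have h2 : ∀ t, (Set.Ioc (h.a i : ℝ) (h.b i : ℝ)).indicator (fun _ => h.c i) t *
        (Set.Ioc (h.a j : ℝ) (h.b j : ℝ)).indicator (fun _ => h.c j) t
      = (Set.Ioc (max (h.a i) (h.a j) : ℝ) (min (h.b i) (h.b j) : ℝ)).indicator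
        (fun _ => h.c i * h.c j) t := fun t => by
    rw [← Set.Ioc_inter_Ioc, Set.inter_indicator_mul]
  simp_rw [h2]
  rw [integral_indicator measurableSet_Ioc, Measure.restrict_restrict measurableSet_Ioc,
    Set.inter_eq_left.2]
  · rw [setIntegral_const, Real.volume_real_Ioc, smul_eq_mul, mul_comm]
    congr 1
    have ha := h.le i
    have hb := h.le j
    rw [← NNReal.coe_le_coe] at ha hb
    push_cast
    -- The overlap length `max 0 (min b - max a)` equals the combination of four minima, by cases on
    -- the order of the end points.
    grind
  · intro t ht
    exact ((NNReal.coe_nonneg (h.a i)).trans (le_max_left _ _)).trans ht.1.le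

/-- The integral is a linear image of the Gaussian vector of values of `W` at the finitely many end
points. -/
lemma hasGaussianLaw_stochIntegral {P : Measure Ω} {W : ℝ≥0 → Ω → ℝ}
    (hW : IsPreBrownianReal W P) (h : StepFunction) : HasGaussianLaw (h.stochIntegral W) P := by
  classical
  let I : Finset ℝ≥0 := Finset.univ.image h.a ∪ Finset.univ.image h.b
  have ha : ∀ i, h.a i ∈ I := fun i => by simp [I]
  have hb : ∀ i, h.b i ∈ I := fun i => by simp [I]
  let L : (I → ℝ) →L[ℝ] ℝ := ∑ i, h.c i •
    (ContinuousLinearMap.proj (R := ℝ) (φ := fun _ : I => ℝ) ⟨h.b i, hb i⟩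
      - ContinuousLinearMap.proj (R := ℝ) (φ := fun _ : I => ℝ) ⟨h.a i, ha i⟩)
  have hL : h.stochIntegral W = fun ω => L (I.restrict (W · ω)) := by
    ext ω
    simp [L, stochIntegral]
  rw [hL]
  exact (hW.isGaussianProcess.hasGaussianLaw I).map_fun L

section

variable {P : Measure Ω} {W : ℝ≥0 → Ω → ℝ}

lemma integral_stochIntegral (hW : IsPreBrownianReal W P) (h : StepFunction) :
    ∫ ω, h.stochIntegral W ω ∂P = 0 := by
  simp only [stochIntegral]
  rw [integral_finsetSum]
  · refine Finset.sum_eq_zero fun i _ => ?_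
    rw [integral_const_mul, integral_sub (hW.integrable_eval _) (hW.integrable_eval _),
      hW.integral_eval, hW.integral_eval]
    simp
  · exact fun i _ => ((hW.integrable_eval _).sub (hW.integrable_eval _)).const_mul _

lemma variance_stochIntegral [IsProbabilityMeasure P] (hW : IsPreBrownianReal W P) (h : StepFunction) :
    Var[h.stochIntegral W; P] = ∫ t in Set.Ici (0 : ℝ), h.eval t ^ 2 := by
  have hm : ∀ t, MemLp (fun ω => W t ω) 2 P := fun t =>
    (hW.isGaussianProcess.hasGaussianLaw_eval t).memLp_two
  have hm' : ∀ i, MemLp (fun ω => h.c i * (W (h.b i) ω - W (h.a i) ω)) 2 P := fun i =>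
    ((hm _).sub (hm _)).const_mul _
  rw [integral_eval_sq]
  unfold stochIntegral
  rw [variance_fun_sum hm']
  refine Finset.sum_congr rfl fun i _ => Finset.sum_congr rfl fun j _ => ?_
  rw [covariance_const_mul_left, covariance_const_mul_right,
    covariance_fun_sub_fun_sub (hm _) (hm _) (hm _) (hm _)]
  simp only [hW.covariance_fun_eval]
  ring

lemma map_stochIntegral [IsProbabilityMeasure P] (hW : IsPreBrownianReal W P) (h : StepFunction) :
    P.map (h.stochIntegral W)
      = gaussianReal 0 (∫ t in Set.Ici (0 : ℝ), h.eval t ^ 2).toNNReal := by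
  rw [(hasGaussianLaw_stochIntegral hW h).map_eq_gaussianReal, integral_stochIntegral hW,
    variance_stochIntegral hW]

lemma memLp_stochIntegral (hW : IsPreBrownianReal W P) (h : StepFunction) :
    MemLp (h.stochIntegral W) 2 P := (hasGaussianLaw_stochIntegral hW h).memLp_two

end

end StepFunction

lemma eLpNorm_two_eq_sqrt_integral {α : Type*} [MeasurableSpace α] {μ : Measure α} {f : α → ℝ}
    (hf : MemLp f 2 μ) : eLpNorm f 2 μ = ENNReal.ofReal (√(∫ a, f a ^ 2 ∂μ)) := by
  rw [hf.eLpNorm_eq_integral_rpow_norm two_ne_zero ENNReal.ofNat_ne_top, Real.sqrt_eq_rpow]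
  simp

/-! ### Isometry and density of step functions. -/

namespace StepFunction

lemma eLpNorm_stochIntegral {P : Measure Ω} [IsProbabilityMeasure P] {W : ℝ≥0 → Ω → ℝ}
    (hW : IsPreBrownianReal W P) (h : StepFunction) :
    eLpNorm (h.stochIntegral W) 2 P = eLpNorm h.eval 2 (volume.restrict (Set.Ici 0)) := by
  rw [eLpNorm_two_eq_sqrt_integral (memLp_stochIntegral hW h),
    eLpNorm_two_eq_sqrt_integral h.memLp_eval, ← variance_stochIntegral hW h,
    variance_of_integral_eq_zero (hasGaussianLaw_stochIntegral hW h).aemeasurable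
      (integral_stochIntegral hW h)]

/-- Continuous functions are uniformly close, on a bounded interval, to step functions. -/
lemma exists_forall_abs_sub_eval_le {g : ℝ → ℝ} (hg : Continuous g) {R : ℝ} (hR : 0 < R) {δ : ℝ}
    (hδ : 0 < δ) : ∃ h : StepFunction, (∀ t ∈ Set.Ioc 0 R, |g t - h.eval t| ≤ δ) ∧
      ∀ t ∉ Set.Ioc 0 R, h.eval t = 0 := by
  have huc := isCompact_Icc.uniformContinuousOn_of_continuous (s := Set.Icc 0 R) hg.continuousOn
  obtain ⟨ε, hε, H⟩ := Metric.uniformContinuousOn_iff.1 huc δ hδ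
  obtain ⟨N, hN⟩ := exists_nat_gt (R / ε)
  have hN0 : (0 : ℝ) < N := (by positivity : (0 : ℝ) < R / ε).trans hN
  have hRN : R / N < ε := by
    rw [div_lt_iff₀ hε] at hN
    rw [div_lt_iff₀ hN0]; linarith
  have hRNpos : 0 < R / N := by positivity
  set d : ℝ := R / N with hd
  have hdN : d * N = R := by rw [hd]; field_simp
  let h : StepFunction :=
    { n := N
      c := fun i => g (i * d)
      a := fun i => ⟨(i : ℝ) * d, by positivity⟩
      b := fun i => ⟨((i : ℝ) + 1) * d, by positivity⟩
      le := fun i => show (i : ℝ) * d ≤ ((i : ℝ) + 1) * d by nlinarith }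
  have hmem : ∀ (i : Fin N) (t : ℝ), t ∈ Set.Ioc (h.a i : ℝ) (h.b i : ℝ) ↔
      (i : ℝ) * d < t ∧ t ≤ ((i : ℝ) + 1) * d := fun i t => Iff.rfl
  refine ⟨h, fun t ht => ?_, fun t ht => ?_⟩
  -- The cells `(k d, (k + 1) d]` are closed on the right, so the cell of `t` is found with the
  -- ceiling, not the floor.
  · obtain ⟨k, hk⟩ : ∃ k, ⌈t / d⌉₊ = k + 1 :=
      Nat.exists_eq_succ_of_ne_zero (Nat.ceil_pos.2 (div_pos ht.1 hRNpos)).ne'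
    have hk1 : (k : ℝ) < t / d := Nat.lt_ceil.1 (by omega)
    have hk2 : t / d ≤ k + 1 := by exact_mod_cast Nat.ceil_le.1 hk.le
    rw [lt_div_iff₀ hRNpos] at hk1
    rw [div_le_iff₀ hRNpos] at hk2
    have hkN : k < N := by
      have : (k : ℝ) * d < N * d := by linarith [ht.2]
      exact_mod_cast lt_of_mul_lt_mul_right this hRNpos.le
    have heval : h.eval t = g (k * d) := by
      rw [eval, Finset.sum_eq_single (⟨k, hkN⟩ : Fin N)]
      · rw [Set.indicator_of_mem]
        rw [hmem]
        exact ⟨hk1, hk2⟩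
      · intro j _ hj
        rw [Set.indicator_of_notMem]
        rw [hmem]
        rintro ⟨h1, h2⟩
        apply hj
        have e1 : (j : ℝ) < k + 1 := lt_of_mul_lt_mul_right (h1.trans_le hk2) hRNpos.le
        have e2 : (k : ℝ) < j + 1 := lt_of_mul_lt_mul_right (hk1.trans_le h2) hRNpos.le
        have e1' : (j : ℕ) < k + 1 := by exact_mod_cast e1
        have e2' : k < (j : ℕ) + 1 := by exact_mod_cast e2
        exact Fin.ext (by change (j : ℕ) = k; omega)
      · simp
    rw [heval, ← Real.dist_eq]
    refine (H t ⟨ht.1.le, ht.2⟩ _ ⟨by positivity, hk1.le.trans ht.2⟩ ?_).le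
    rw [Real.dist_eq, abs_of_pos (by linarith)]
    linarith
  · rw [eval]
    refine Finset.sum_eq_zero fun i _ => ?_
    rw [Set.indicator_of_notMem]
    rw [hmem]
    rintro ⟨h1, h2⟩
    refine ht ⟨lt_of_le_of_lt (by positivity) h1, h2.trans ?_⟩
    have : ((i : ℕ) : ℝ) + 1 ≤ N := by exact_mod_cast i.2
    nlinarith

/-- Step functions are dense in `L²([0, ∞))`. -/
lemma exists_eLpNorm_sub_le {f : ℝ → ℝ} (hf : MemLp f 2 (volume.restrict (Set.Ici 0)))
    {ε : ℝ≥0∞} (hε : ε ≠ 0) :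
    ∃ h : StepFunction, eLpNorm (f - h.eval) 2 (volume.restrict (Set.Ici 0)) ≤ ε := by
  have hε2 : ε / 2 ≠ 0 := ENNReal.div_ne_zero.2 ⟨hε, by simp⟩
  obtain ⟨g, hgc, hfg, hg, hgm⟩ :=
    hf.exists_hasCompactSupport_eLpNorm_sub_le ENNReal.ofNat_ne_top hε2
  obtain ⟨R, hR0, hR⟩ : ∃ R > 0, ∀ t, R < t → g t = 0 := by
    obtain ⟨R, hR⟩ := hgc.isCompact.isBounded.subset_closedBall 0
    refine ⟨max R 1, by positivity, fun t ht => image_eq_zero_of_notMem_tsupport fun h => ?_⟩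
    have := hR h
    rw [mem_closedBall_zero_iff, Real.norm_eq_abs] at this
    linarith [le_abs_self t, le_max_left R 1]
  -- A uniform error `δ` on `(0, R]` costs at most `δ R^(1/2)` in `L²`.
  obtain ⟨δ, hδ, hδε⟩ : ∃ δ : ℝ, 0 < δ ∧
      ENNReal.ofReal δ * (ENNReal.ofReal R) ^ (1 / 2 : ℝ) ≤ ε / 2 := by
    have hR2 : (ENNReal.ofReal R) ^ (1 / 2 : ℝ) ≠ ∞ := by
      simp
    have ht : Tendsto (fun δ : ℝ => ENNReal.ofReal δ * (ENNReal.ofReal R) ^ (1 / 2 : ℝ))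
        (𝓝[>] 0) (𝓝 (ENNReal.ofReal 0 * (ENNReal.ofReal R) ^ (1 / 2 : ℝ))) :=
      ENNReal.Tendsto.mul_const
        ((ENNReal.continuous_ofReal.tendsto 0).mono_left nhdsWithin_le_nhds) (Or.inr hR2)
    rw [ENNReal.ofReal_zero, zero_mul] at ht
    have := (ht.eventually (Iic_mem_nhds (pos_iff_ne_zero.2 hε2))).and self_mem_nhdsWithin
    obtain ⟨δ, h1, h2⟩ := this.exists
    exact ⟨δ, h2, h1⟩
  obtain ⟨h, h1, h2⟩ := exists_forall_abs_sub_eval_le hg hR0 hδ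
  refine ⟨h, ?_⟩
  have hgh : eLpNorm (g - h.eval) 2 (volume.restrict (Set.Ici 0)) ≤ ε / 2 := by
    -- Equality may fail at `t = 0`, which lies in `[0, ∞)` but not in `(0, R]`.
    have hae : (g - h.eval) =ᵐ[volume.restrict (Set.Ici 0)]
        (Set.Ioc 0 R).indicator (g - h.eval) := by
      have h0 : ∀ᵐ t : ℝ ∂volume.restrict (Set.Ici 0), t ≠ 0 :=
        ae_restrict_of_ae (by simp [ae_iff])
      filter_upwards [ae_restrict_mem measurableSet_Ici, h0] with t ht ht0
      by_cases htR : t ∈ Set.Ioc 0 R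
      · rw [Set.indicator_of_mem htR]
      · rw [Set.indicator_of_notMem htR, Pi.sub_apply, h2 t htR, hR t, sub_zero]
        by_contra hle
        exact htR ⟨lt_of_le_of_ne ht (Ne.symm ht0), not_lt.1 hle⟩
    rw [eLpNorm_congr_ae hae]
    refine (eLpNorm_indicator_sub_le_of_dist_bdd _ ENNReal.ofNat_ne_top measurableSet_Ioc hδ.le
      (fun t ht => ?_)).trans ?_
    · rw [Real.dist_eq]; exact h1 t ht
    · refine le_trans ?_ hδε
      rw [ENNReal.toReal_ofNat]
      gcongr
      exact (Measure.restrict_apply_le _ _).trans (by simp)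
  calc eLpNorm (f - h.eval) 2 (volume.restrict (Set.Ici 0))
      = eLpNorm ((f - g) + (g - h.eval)) 2 (volume.restrict (Set.Ici 0)) := by
        rw [sub_add_sub_cancel]
    _ ≤ ε / 2 + ε / 2 := (eLpNorm_add_le (hf.1.sub hgm.1) (hgm.1.sub h.memLp_eval.1)
        one_le_two).trans (add_le_add hfg hgh)
    _ = ε := ENNReal.add_halves ε

lemma exists_seq_tendsto {f : ℝ → ℝ} (hf : MemLp f 2 (volume.restrict (Set.Ici 0))) :
    ∃ h : ℕ → StepFunction,
      Tendsto (fun n => eLpNorm (fun t => f t - (h n).eval t) 2 (volume.restrict (Set.Ici 0)))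
        atTop (𝓝 0) := by
  choose h hh using fun n : ℕ => exists_eLpNorm_sub_le hf (ε := ((n : ℝ≥0∞) + 1)⁻¹) (by simp)
  refine ⟨h, tendsto_of_tendsto_of_tendsto_of_le_of_le tendsto_const_nhds ?_
    (fun _ => zero_le) hh⟩
  have := (tendsto_add_atTop_iff_nat 1).2 ENNReal.tendsto_inv_nat_nhds_zero
  simpa using this

end StepFunction

/-! ### The stochastic integral of a deterministic integrand -/

lemma tendsto_toLp_of_tendsto_eLpNorm {α : Type*} [MeasurableSpace α] {μ : Measure α}
    {f : α → ℝ} {g : ℕ → α → ℝ} (hf : MemLp f 2 μ) (hg : ∀ n, MemLp (g n) 2 μ)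
    (h : Tendsto (fun n => eLpNorm (fun a => f a - g n a) 2 μ) atTop (𝓝 0)) :
    Tendsto (fun n => (hg n).toLp (g n)) atTop (𝓝 (hf.toLp f)) := by
  rw [tendsto_iff_edist_tendsto_0]
  simp_rw [edist_comm, Lp.edist_toLp_toLp]
  exact h

lemma norm_toLp_sq {α : Type*} [MeasurableSpace α] {μ : Measure α} {f : α → ℝ}
    (hf : MemLp f 2 μ) : ‖hf.toLp f‖ ^ 2 = ∫ a, f a ^ 2 ∂μ := by
  rw [Lp.norm_toLp, eLpNorm_two_eq_sqrt_integral hf, ENNReal.toReal_ofReal (Real.sqrt_nonneg _),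
    Real.sq_sqrt (integral_nonneg fun _ => sq_nonneg _)]

namespace HasStochIntegral

variable {P : Measure Ω} [IsProbabilityMeasure P] {W : ℝ≥0 → Ω → ℝ}

/-- By linearity the isometry applies to the difference of two step functions, so Cauchy sequences
and limits of distances transfer between the two `L²` spaces. -/
lemma edist_toLp_stochIntegral (hW : IsPreBrownianReal W P) (h k : StepFunction) :
    edist ((h.memLp_stochIntegral hW).toLp (h.stochIntegral W))
        ((k.memLp_stochIntegral hW).toLp (k.stochIntegral W))
      = edist (h.memLp_eval.toLp h.eval) (k.memLp_eval.toLp k.eval) := by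
  rw [Lp.edist_toLp_toLp, Lp.edist_toLp_toLp]
  have h1 : h.stochIntegral W - k.stochIntegral W = (h.sub k).stochIntegral W := by
    ext ω; simp [StepFunction.stochIntegral_sub]
  have h2 : h.eval - k.eval = (h.sub k).eval := by
    ext t; simp [StepFunction.eval_sub]
  rw [h1, h2, StepFunction.eLpNorm_stochIntegral hW]

/-- Every square-integrable deterministic function has a stochastic integral. -/
lemma exists_of_memLp (hW : IsPreBrownianReal W P) {f : ℝ → ℝ}
    (hf : MemLp f 2 (volume.restrict (Set.Ici 0))) : ∃ I, HasStochIntegral P W f I := by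
  obtain ⟨h, hh⟩ := StepFunction.exists_seq_tendsto hf
  have hc := (tendsto_toLp_of_tendsto_eLpNorm hf (fun n => (h n).memLp_eval) hh).cauchySeq
  have hc' : CauchySeq fun n =>
      ((h n).memLp_stochIntegral hW).toLp ((h n).stochIntegral W) := by
    rw [EMetric.cauchySeq_iff] at hc ⊢
    simpa only [edist_toLp_stochIntegral hW] using hc
  obtain ⟨I, hI⟩ := cauchySeq_tendsto_of_complete hc'
  refine ⟨I, hf, Lp.memLp I, h, hh, ?_⟩
  rw [tendsto_iff_edist_tendsto_0] at hI
  refine hI.congr fun n => ?_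
  rw [edist_comm, Lp.edist_def]
  refine eLpNorm_congr_ae ?_
  filter_upwards [MemLp.coeFn_toLp ((h n).memLp_stochIntegral hW)] with ω hω
  rw [Pi.sub_apply, hω]

/-- The Itô isometry. -/
lemma eLpNorm_sub (hW : IsPreBrownianReal W P) {f g : ℝ → ℝ} {I J : Ω → ℝ}
    (hI : HasStochIntegral P W f I) (hJ : HasStochIntegral P W g J) :
    eLpNorm (I - J) 2 P = eLpNorm (f - g) 2 (volume.restrict (Set.Ici 0)) := by
  obtain ⟨hf, hIm, h, hh, hhI⟩ := hI
  obtain ⟨hg, hJm, k, hk, hkJ⟩ := hJ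
  have h1 := (tendsto_toLp_of_tendsto_eLpNorm hf (fun n => (h n).memLp_eval) hh).edist
    (tendsto_toLp_of_tendsto_eLpNorm hg (fun n => (k n).memLp_eval) hk)
  have h2 := (tendsto_toLp_of_tendsto_eLpNorm hIm (fun n => (h n).memLp_stochIntegral hW)
    hhI).edist
    (tendsto_toLp_of_tendsto_eLpNorm hJm (fun n => (k n).memLp_stochIntegral hW) hkJ)
  simp only [edist_toLp_stochIntegral hW] at h2
  have := tendsto_nhds_unique h2 h1
  rwa [Lp.edist_toLp_toLp, Lp.edist_toLp_toLp] at this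

/-- The isometry with equal integrands shows independence of the approximating step functions. -/
lemma ae_eq (hW : IsPreBrownianReal W P) {f : ℝ → ℝ} {I J : Ω → ℝ}
    (hI : HasStochIntegral P W f I) (hJ : HasStochIntegral P W f J) : I =ᵐ[P] J := by
  have h := eLpNorm_sub hW hI hJ
  rw [sub_self, eLpNorm_zero, eLpNorm_eq_zero_iff (hI.2.1.1.sub hJ.2.1.1) two_ne_zero] at h
  filter_upwards [h] with ω hω
  exact sub_eq_zero.1 hω

/-- The stochastic integral of `f` has the centered normal law with variance `∫ f²`. -/
lemma map_eq_gaussianReal (hW : IsPreBrownianReal W P) {f : ℝ → ℝ} {I : Ω → ℝ}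
    (hI : HasStochIntegral P W f I) :
    P.map I = gaussianReal 0 (∫ t in Set.Ici (0 : ℝ), f t ^ 2).toNNReal := by
  obtain ⟨hf, hIm, h, hh, hhI⟩ := hI
  have hvar : Tendsto (fun n => ∫ t in Set.Ici (0 : ℝ), (h n).eval t ^ 2) atTop
      (𝓝 (∫ t in Set.Ici (0 : ℝ), f t ^ 2)) := by
    have := (tendsto_toLp_of_tendsto_eLpNorm hf (fun n => (h n).memLp_eval) hh).norm.pow 2
    simpa only [norm_toLp_sq] using this
  -- Convergence in `L²` gives convergence in measure, hence in law; the Gaussian characteristic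
  -- functions converge because their variances do.
  have hm : TendstoInMeasure P (fun n => (h n).stochIntegral W) atTop I := by
    refine tendstoInMeasure_of_tendsto_eLpNorm two_ne_zero
      (fun n => ((h n).memLp_stochIntegral hW).1) hIm.1 (hhI.congr fun n => ?_)
    rw [eLpNorm_sub_comm]
    rfl
  have hd := (hm.tendstoInDistribution
    fun n => ((h n).memLp_stochIntegral hW).1.aemeasurable).tendsto
  replace hd := ProbabilityMeasure.tendsto_iff_tendsto_charFun.1 hd
  have : IsProbabilityMeasure (P.map I) := Measure.isProbabilityMeasure_map hIm.1.aemeasurable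
  refine Measure.ext_of_charFun (funext fun t => tendsto_nhds_unique (hd t) ?_)
  simp only [ProbabilityMeasure.coe_mk, StepFunction.map_stochIntegral hW, charFun_gaussianReal]
  refine (Complex.continuous_exp.tendsto _).comp (tendsto_const_nhds.sub ?_)
  refine Tendsto.div_const (Tendsto.mul_const _ ?_) _
  have hnn := (continuous_real_toNNReal.tendsto _).comp hvar
  exact (Complex.continuous_ofReal.tendsto _).comp ((NNReal.continuous_coe.tendsto _).comp hnn)

end HasStochIntegral

/-! ### The total cost -/

namespace IsDeterministicPolicy

variable {M x : ℝ} {π : ℝ → ℝ}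

lemma memLp_rate (h : IsDeterministicPolicy M x π) :
    MemLp π 2 (volume.restrict (Set.Ici 0)) := by
  have hm : AEStronglyMeasurable π (volume.restrict (Set.Ici 0)) :=
    ((aemeasurable_restrict_iff_comap_subtype measurableSet_Ici).2
      h.measurable.aemeasurable).aestronglyMeasurable
  exact (memLp_two_iff_integrable_sq hm).2 h.rate_sq_integrable

lemma memLp_indicator_rate (h : IsDeterministicPolicy M x π) :
    MemLp ((Set.Ici 0).indicator π) 2 volume :=
  (memLp_indicator_iff_restrict measurableSet_Ici).2 h.memLp_rate

lemma intervalIntegrable_indicator_rate (h : IsDeterministicPolicy M x π) (a b : ℝ) :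
    IntervalIntegrable ((Set.Ici 0).indicator π) volume a b :=
  ⟨(h.memLp_indicator_rate.restrict _).integrable one_le_two,
    (h.memLp_indicator_rate.restrict _).integrable one_le_two⟩

/-- Setting the rate to zero at negative times, where it is unconstrained, lets results on
primitives over all of `ℝ` apply. -/
lemma position_indicator_rate (x : ℝ) (π : ℝ → ℝ) {t : ℝ} (ht : 0 ≤ t) :
    position x ((Set.Ici 0).indicator π) t = position x π t := by
  rw [position, position]
  congr 1
  refine intervalIntegral.integral_congr fun s hs => ?_
  rw [Set.uIcc_of_le ht] at hs
  exact Set.indicator_of_mem (show s ∈ Set.Ici 0 from hs.1) _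

lemma continuous_position_indicator_rate (h : IsDeterministicPolicy M x π) :
    Continuous (position x ((Set.Ici 0).indicator π)) :=
  continuous_const.sub
    (intervalIntegral.continuous_primitive (fun a b => h.intervalIntegrable_indicator_rate a b) 0)

lemma continuousOn_position (h : IsDeterministicPolicy M x π) :
    ContinuousOn (position x π) (Set.Ici 0) :=
  h.continuous_position_indicator_rate.continuousOn.congr fun _ ht =>
    (position_indicator_rate x π ht).symm

lemma memLp_position (h : IsDeterministicPolicy M x π) :
    MemLp (position x π) 2 (volume.restrict (Set.Ici 0)) :=
  (memLp_two_iff_integrable_sq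
    (h.continuousOn_position.aestronglyMeasurable measurableSet_Ici)).2 h.position_sq_integrable

end IsDeterministicPolicy

lemma tendsto_eLpNorm_indicator_Ioc_sub {f : ℝ → ℝ}
    (hf : MemLp f 2 (volume.restrict (Set.Ici 0))) :
    Tendsto (fun t : ℝ≥0 => eLpNorm ((Set.Ioc 0 (t : ℝ)).indicator f - f) 2
      (volume.restrict (Set.Ici 0))) atTop (𝓝 0) := by
  have hm : ∀ t : ℝ≥0, MemLp ((Set.Ioc 0 (t : ℝ)).indicator f - f) 2
      (volume.restrict (Set.Ici 0)) := fun t => (hf.indicator measurableSet_Ioc).sub hf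
  have hsq : ∀ (t : ℝ≥0) (s : ℝ), ((Set.Ioc 0 (t : ℝ)).indicator f - f) s ^ 2 ≤ f s ^ 2 := by
    intro t s
    by_cases hs : s ∈ Set.Ioc 0 (t : ℝ)
    · simp [hs, sq_nonneg]
    · simp [hs]
  have h0 : ∀ᵐ t : ℝ ∂volume.restrict (Set.Ici 0), t ≠ 0 :=
    ae_restrict_of_ae (by simp [ae_iff])
  have hint : Tendsto (fun t : ℝ≥0 => ∫ s in Set.Ici (0 : ℝ),
      ((Set.Ioc 0 (t : ℝ)).indicator f - f) s ^ 2) atTop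
      (𝓝 (∫ _ in Set.Ici (0 : ℝ), (0 : ℝ))) := by
    refine tendsto_integral_filter_of_dominated_convergence (fun s => f s ^ 2)
      (Eventually.of_forall fun t => (hm t).integrable_sq.1)
      (Eventually.of_forall fun t => Eventually.of_forall fun s => ?_) hf.integrable_sq ?_
    · rw [Real.norm_eq_abs, abs_of_nonneg (sq_nonneg _)]
      exact hsq t s
    · filter_upwards [ae_restrict_mem measurableSet_Ici, h0] with s hs hs0
      refine tendsto_const_nhds.congr' ?_
      filter_upwards [eventually_ge_atTop s.toNNReal] with t ht
      have hst : s ∈ Set.Ioc 0 (t : ℝ) :=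
        ⟨lt_of_le_of_ne hs (Ne.symm hs0), Real.toNNReal_le_iff_le_coe.1 ht⟩
      simp [hst]
  rw [integral_zero] at hint
  have := (ENNReal.continuous_ofReal.tendsto _).comp ((Real.continuous_sqrt.tendsto _).comp hint)
  rw [Real.sqrt_zero, ENNReal.ofReal_zero] at this
  exact this.congr fun t => (eLpNorm_two_eq_sqrt_integral (hm t)).symm

section

variable {P : Measure Ω} [IsProbabilityMeasure P] {W : ℝ≥0 → Ω → ℝ} {η σ M x : ℝ} {π : ℝ → ℝ}

lemma IsDeterministicPolicy.memLp_integrand (h : IsDeterministicPolicy M x π) (σ : ℝ) :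
    MemLp (fun s => σ * position x π s) 2 (volume.restrict (Set.Ici 0)) :=
  h.memLp_position.const_mul σ

/-- The error splits into the tail of the impact cost and, by the Itô isometry, the `L²` tail of the
integrand. -/
lemma IsCostProcess.tendsto_eLpNorm (hW : IsPreBrownianReal W P)
    (h : IsDeterministicPolicy M x π) {C : ℝ≥0 → Ω → ℝ} (hC : IsCostProcess P W η σ x π C)
    {I : Ω → ℝ} (hI : HasStochIntegral P W (fun s => σ * position x π s) I) :
    Tendsto (fun t => eLpNorm
      (fun ω => C t ω - ((∫ s in Set.Ioi (0 : ℝ), 1 / 2 * η * π s ^ 2) - I ω)) 2 P)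
      atTop (𝓝 0) := by
  choose J hJ hCJ using hC
  set m := ∫ s in Set.Ioi (0 : ℝ), 1 / 2 * η * π s ^ 2 with hm
  have hmt : Tendsto (fun t : ℝ≥0 => ENNReal.ofReal
      |(∫ s in (0 : ℝ)..t, 1 / 2 * η * π s ^ 2) - m|) atTop (𝓝 0) := by
    have h1 : Tendsto (fun t : ℝ≥0 => ∫ s in (0 : ℝ)..t, 1 / 2 * η * π s ^ 2) atTop (𝓝 m) :=
      intervalIntegral_tendsto_integral_Ioi 0
        ((h.rate_sq_integrable.mono_set Set.Ioi_subset_Ici_self).const_mul _)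
        (NNReal.tendsto_coe_atTop.2 tendsto_id)
    have h2 := (ENNReal.continuous_ofReal.tendsto _).comp
      ((continuous_abs.tendsto _).comp (h1.sub_const m))
    rw [sub_self, abs_zero, ENNReal.ofReal_zero] at h2
    exact h2
  have hIt := tendsto_eLpNorm_indicator_Ioc_sub (h.memLp_integrand σ)
  have hsum := hmt.add hIt
  rw [add_zero] at hsum
  refine tendsto_of_tendsto_of_tendsto_of_le_of_le tendsto_const_nhds hsum
    (fun _ => zero_le) fun t => ?_
  change _ ≤ _ + _
  rw [← HasStochIntegral.eLpNorm_sub hW (hJ t) hI]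
  calc eLpNorm (fun ω => C t ω - (m - I ω)) 2 P
      = eLpNorm ((fun _ => (∫ s in (0 : ℝ)..t, 1 / 2 * η * π s ^ 2) - m) - (J t - I)) 2 P := by
        refine eLpNorm_congr_ae ?_
        filter_upwards [hCJ t] with ω hω
        rw [hω, Pi.sub_apply, Pi.sub_apply]
        ring
    _ ≤ _ := eLpNorm_sub_le aestronglyMeasurable_const ((hJ t).2.1.1.sub hI.2.1.1) one_le_two
    _ = _ := by
        congr 1
        rw [eLpNorm_const _ two_ne_zero (IsProbabilityMeasure.ne_zero P), measure_univ,
          ENNReal.one_rpow, mul_one, Real.enorm_eq_ofReal_abs]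

lemma exists_isTotalCost (hW : IsPreBrownianReal W P) (h : IsDeterministicPolicy M x π) :
    ∃ C, IsTotalCost P W η σ x π C := by
  obtain ⟨I, hI⟩ := HasStochIntegral.exists_of_memLp hW (h.memLp_integrand σ)
  choose J hJ using fun t : ℝ≥0 => HasStochIntegral.exists_of_memLp hW
    ((h.memLp_integrand σ).indicator (measurableSet_Ioc (a := 0) (b := (t : ℝ))))
  have hC : IsCostProcess P W η σ x π
      fun t ω => (∫ s in (0 : ℝ)..t, 1 / 2 * η * π s ^ 2) - J t ω :=
    fun t => ⟨J t, hJ t, Eventually.of_forall fun _ => rfl⟩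
  exact ⟨fun ω => (∫ s in Set.Ioi (0 : ℝ), 1 / 2 * η * π s ^ 2) - I ω,
    (memLp_const _).sub hI.2.1, _, hC, hC.tendsto_eLpNorm hW h hI⟩

/-- The total cost is the deterministic impact cost minus the stochastic integral of the
position. -/
lemma IsTotalCost.ae_eq (hW : IsPreBrownianReal W P) (h : IsDeterministicPolicy M x π)
    {Cinf : Ω → ℝ} (hC : IsTotalCost P W η σ x π Cinf) {I : Ω → ℝ}
    (hI : HasStochIntegral P W (fun s => σ * position x π s) I) :
    Cinf =ᵐ[P] fun ω => (∫ s in Set.Ioi (0 : ℝ), 1 / 2 * η * π s ^ 2) - I ω := by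
  obtain ⟨hCm, C, hC, hlim⟩ := hC
  have hlim' := hC.tendsto_eLpNorm hW h hI
  have hCt : ∀ t, AEStronglyMeasurable (C t) P := fun t => by
    obtain ⟨J, hJ, hCJ⟩ := hC t
    exact (aestronglyMeasurable_const.sub hJ.2.1.1).congr (EventuallyEq.symm hCJ)
  set D : Ω → ℝ := fun ω => (∫ s in Set.Ioi (0 : ℝ), 1 / 2 * η * π s ^ 2) - I ω with hD
  have hDm : MemLp D 2 P := (memLp_const _).sub hI.2.1
  have h0 : eLpNorm (Cinf - D) 2 P = 0 := by
    have hs := hlim'.add hlim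
    rw [add_zero] at hs
    refine le_antisymm (ge_of_tendsto' hs fun t => ?_) zero_le
    have : Cinf - D = (C t - D) - (C t - Cinf) := by ring
    rw [this]
    exact eLpNorm_sub_le ((hCt t).sub hDm.1) ((hCt t).sub hCm.1) one_le_two
  rw [eLpNorm_eq_zero_iff (hCm.1.sub hDm.1) two_ne_zero] at h0
  filter_upwards [h0] with ω hω
  exact sub_eq_zero.1 hω

lemma isTotalCost_totalCost (hW : IsPreBrownianReal W P) (h : IsDeterministicPolicy M x π) :
    IsTotalCost P W η σ x π (totalCost P W η σ x π) := by
  have hex := exists_isTotalCost (η := η) (σ := σ) hW h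
  rw [totalCost, dif_pos hex]
  exact hex.choose_spec

lemma IsTotalCost.ae_eq_totalCost (hW : IsPreBrownianReal W P)
    (h : IsDeterministicPolicy M x π) {C : Ω → ℝ} (hC : IsTotalCost P W η σ x π C) :
    C =ᵐ[P] totalCost P W η σ x π := by
  obtain ⟨I, hI⟩ := HasStochIntegral.exists_of_memLp hW (h.memLp_integrand σ)
  exact (hC.ae_eq hW h hI).trans ((isTotalCost_totalCost hW h).ae_eq hW h hI).symm

/-- The total cost is normally distributed. -/
lemma map_totalCost (hW : IsPreBrownianReal W P) (h : IsDeterministicPolicy M x π) :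
    P.map (totalCost P W η σ x π)
      = gaussianReal (1 / 2 * η * ∫ s in Set.Ici (0 : ℝ), π s ^ 2)
        (σ ^ 2 * ∫ s in Set.Ici (0 : ℝ), position x π s ^ 2).toNNReal := by
  obtain ⟨I, hI⟩ := HasStochIntegral.exists_of_memLp hW (h.memLp_integrand σ)
  rw [Measure.map_congr ((isTotalCost_totalCost hW h).ae_eq hW h hI)]
  have hlaw : HasLaw I (gaussianReal 0
      (σ ^ 2 * ∫ s in Set.Ici (0 : ℝ), position x π s ^ 2).toNNReal) P := by
    refine ⟨hI.2.1.1.aemeasurable, ?_⟩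
    rw [hI.map_eq_gaussianReal hW, ← integral_const_mul]
    simp only [mul_pow]
  have := (gaussianReal_const_sub hlaw (1 / 2 * η * ∫ s in Set.Ici (0 : ℝ), π s ^ 2)).map_eq
  rw [sub_zero] at this
  rw [← this, integral_const_mul, integral_Ici_eq_integral_Ioi]

end

/-! ### Conditional value-at-risk of a normal random variable -/

lemma continuous_cdf_gaussianReal : Continuous (cdf (gaussianReal 0 1)) := by
  have := nullSingletonClass_gaussianReal (μ := 0) (v := 1) one_ne_zero
  refine continuous_iff_continuousAt.2 fun a => ?_
  have h0 : (cdf (gaussianReal 0 1)).measure {a} = 0 := by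
    rw [measure_cdf]
    exact measure_singleton a
  rw [StieltjesFunction.measure_singleton, ENNReal.ofReal_eq_zero] at h0
  rw [(monotone_cdf _).continuousAt_iff_leftLim_eq_rightLim, StieltjesFunction.rightLim_eq]
  exact le_antisymm ((monotone_cdf _).leftLim_le le_rfl) (by linarith)

/-- Continuity makes the superlevel set closed, so its infimum belongs to it, and supplies a point
with value exactly `p` for the other inequality. -/
lemma cdf_normalQuantile {p : ℝ} (hp : p ∈ Set.Ioo (0 : ℝ) 1) :
    cdf (gaussianReal 0 1) (normalQuantile p) = p := by
  set F := cdf (gaussianReal 0 1)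
  have hc : Continuous F := continuous_cdf_gaussianReal
  obtain ⟨a, ha⟩ := ((tendsto_cdf_atBot (gaussianReal 0 1)).eventually (gt_mem_nhds hp.1)).exists
  obtain ⟨b, hb⟩ := ((tendsto_cdf_atTop (gaussianReal 0 1)).eventually (lt_mem_nhds hp.2)).exists
  obtain ⟨z, hz⟩ := mem_range_of_exists_le_of_exists_ge hc ⟨a, le_of_lt ha⟩ ⟨b, le_of_lt hb⟩
  have hne : {z : ℝ | p ≤ F z}.Nonempty := ⟨z, hz.ge⟩
  have hbdd : BddBelow {z : ℝ | p ≤ F z} := by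
    refine ⟨a, fun y hy => ?_⟩
    by_contra hlt
    exact absurd ((hy.trans (monotone_cdf _ (not_le.1 hlt).le)).trans_lt ha) (lt_irrefl _)
  have hcl : IsClosed {z : ℝ | p ≤ F z} := isClosed_le continuous_const hc
  refine le_antisymm ?_ (hcl.csInf_mem hne hbdd)
  exact (monotone_cdf _ (csInf_le hbdd hz.ge)).trans hz.le

lemma kappa_pos (q : ℝ) : 0 < kappa q := gaussianPDFReal_pos _ _ _ one_ne_zero

lemma measureReal_Ioi_normalQuantile {q : ℝ} (hq : q ∈ Set.Ioo (0 : ℝ) 1) :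
    (gaussianReal 0 1).real (Set.Ioi (normalQuantile (1 - q))) = q := by
  have h := cdf_normalQuantile (p := 1 - q) ⟨by linarith [hq.2], by linarith [hq.1]⟩
  rw [cdf_eq_real] at h
  rw [← Set.compl_Iic, probReal_compl_eq_one_sub measurableSet_Iic, h]
  ring

lemma hasDerivAt_gaussianPDFReal (x : ℝ) :
    HasDerivAt (gaussianPDFReal 0 1) (-(x * gaussianPDFReal 0 1 x)) x := by
  have h : gaussianPDFReal 0 1 = fun x => (√(2 * Real.pi))⁻¹ * Real.exp (-x ^ 2 / 2) := by
    ext x; simp [gaussianPDFReal]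
  rw [h]
  have h1 : HasDerivAt (fun x : ℝ => -x ^ 2 / 2) (-x) x :=
    ((hasDerivAt_pow 2 x).fun_neg.div_const 2).congr_deriv (by simp; ring)
  exact (h1.exp.const_mul (√(2 * Real.pi))⁻¹).congr_deriv (by ring)

lemma tendsto_gaussianPDFReal_atTop : Tendsto (gaussianPDFReal 0 1) atTop (𝓝 0) := by
  have h : gaussianPDFReal 0 1 = fun x => (√(2 * Real.pi))⁻¹ * Real.exp (-(x ^ 2 / 2)) := by
    ext x; simp [gaussianPDFReal, neg_div]
  rw [h, ← mul_zero (√(2 * Real.pi))⁻¹]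
  refine Tendsto.const_mul _ (Real.tendsto_exp_neg_atTop_nhds_zero.comp ?_)
  exact (tendsto_pow_atTop two_ne_zero).atTop_div_const two_pos

lemma integrable_mul_gaussianPDFReal : Integrable fun x => x * gaussianPDFReal 0 1 x := by
  have h := memLp_one_iff_integrable.1 (memLp_id_gaussianReal (μ := 0) (v := 1) 1)
  rw [gaussianReal_of_var_ne_zero _ one_ne_zero,
    integrable_withDensity_iff (measurable_gaussianPDF _ _)
      (Eventually.of_forall fun _ => gaussianPDF_lt_top)] at h
  simpa [toReal_gaussianPDF] using h

/-- The function `-φ` is an antiderivative of `x φ(x)` and vanishes at infinity. -/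
lemma setIntegral_Ioi_id_gaussianReal (z : ℝ) :
    ∫ x in Set.Ioi z, x ∂gaussianReal 0 1 = gaussianPDFReal 0 1 z := by
  rw [← integral_indicator measurableSet_Ioi,
    integral_gaussianReal_eq_integral_smul one_ne_zero]
  have h1 : ∀ x, gaussianPDFReal 0 1 x • (Set.Ioi z).indicator (fun x => x) x
      = (Set.Ioi z).indicator (fun x => x * gaussianPDFReal 0 1 x) x := fun x => by
    by_cases hx : x ∈ Set.Ioi z <;> simp [hx, mul_comm]
  simp_rw [h1]
  rw [integral_indicator measurableSet_Ioi]
  have h2 := integral_Ioi_of_hasDerivAt_of_tendsto (a := z) (f := fun x => -gaussianPDFReal 0 1 x)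
    (f' := fun x => x * gaussianPDFReal 0 1 x) (m := 0)
    (hasDerivAt_gaussianPDFReal z).neg.continuousAt.continuousWithinAt
    (fun x _ => by simpa using (hasDerivAt_gaussianPDFReal x).fun_neg)
    integrable_mul_gaussianPDFReal.integrableOn
    (by simpa using tendsto_gaussianPDFReal_atTop.neg)
  rw [h2]
  ring

section

variable {P : Measure Ω}

lemma integrable_mul_of_mem_scvarEnvelope {q : ℝ} {C Q : Ω → ℝ} (hC : Integrable C P)
    (hQ : Q ∈ scvarEnvelope P q) : Integrable (fun ω => C ω * Q ω) P :=
  hC.mul_bdd (c := 1) hQ.1 (by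
    filter_upwards [hQ.2.1] with ω hω
    rw [Real.norm_eq_abs, abs_le]
    constructor <;> linarith [hω.1, hω.2])

lemma integrable_of_mem_scvarEnvelope [IsProbabilityMeasure P] {q : ℝ} {Q : Ω → ℝ}
    (hQ : Q ∈ scvarEnvelope P q) : Integrable Q P := by
  simpa using integrable_mul_of_mem_scvarEnvelope (integrable_const (1 : ℝ)) hQ

/-- The scaled conditional value-at-risk of `m + s Z` for a standard normal `Z`. -/
lemma scvar_eq_of_hasLaw [IsProbabilityMeasure P] {q : ℝ} (hq : q ∈ Set.Ioo (0 : ℝ) 1) {m s : ℝ} (hs : 0 ≤ s)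
    {Z C : Ω → ℝ} (hZ : HasLaw Z (gaussianReal 0 1) P) (hC : C =ᵐ[P] fun ω => m + s * Z ω) :
    scvar P q C = q * m + s * kappa q := by
  set z := normalQuantile (1 - q) with hz
  have hZi : Integrable Z P := by
    refine (memLp_one_iff_integrable.1 ?_)
    have h := memLp_id_gaussianReal (μ := 0) (v := 1) 1
    rw [ENNReal.coe_one, ← hZ.map_eq, memLp_map_measure_iff (by fun_prop) hZ.aemeasurable] at h
    exact h
  have hcomp : ∀ f : ℝ → ℝ, Measurable f →
      ∫ ω, (Set.Ioi z).indicator f (Z ω) ∂P = ∫ x in Set.Ioi z, f x ∂gaussianReal 0 1 := by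
    intro f hf
    rw [← integral_indicator measurableSet_Ioi, ← hZ.map_eq, integral_map hZ.aemeasurable
      (hf.indicator measurableSet_Ioi).aestronglyMeasurable]
  -- The maximizer, as in the Neyman–Pearson lemma: full weight on the upper tail of probability
  -- `q`.
  set Q₀ : Ω → ℝ := fun ω => (Set.Ioi z).indicator (fun _ => (1 : ℝ)) (Z ω) with hQ₀
  have hQ₀m : Q₀ ∈ scvarEnvelope P q := by
    refine ⟨((measurable_const.indicator measurableSet_Ioi).comp_aemeasurable
      hZ.aemeasurable).aestronglyMeasurable, Eventually.of_forall fun ω => ?_, ?_⟩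
    · by_cases h : Z ω ∈ Set.Ioi z <;> simp [hQ₀, h]
    · rw [hcomp _ measurable_const, setIntegral_const, measureReal_Ioi_normalQuantile hq]
      simp
  have hZQ₀ : ∫ ω, Z ω * Q₀ ω ∂P = kappa q := by
    have : ∀ ω, Z ω * Q₀ ω = (Set.Ioi z).indicator (fun x => x) (Z ω) := fun ω => by
      by_cases h : Z ω ∈ Set.Ioi z <;> simp [hQ₀, h]
    simp_rw [this]
    rw [hcomp _ measurable_id', setIntegral_Ioi_id_gaussianReal, kappa]
  have hZQ : ∀ Q ∈ scvarEnvelope P q, ∫ ω, Z ω * Q ω ∂P ≤ kappa q := by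
    intro Q hQ
    have h1 := integrable_mul_of_mem_scvarEnvelope hZi hQ
    have h2 := integrable_mul_of_mem_scvarEnvelope hZi hQ₀m
    have h3 := integrable_of_mem_scvarEnvelope hQ
    have h4 := integrable_of_mem_scvarEnvelope hQ₀m
    -- Almost surely `(Z - z) (Q₀ - Q) ≥ 0`; subtracting `z` shifts both sides equally, as `Q` and
    -- `Q₀` have mean `q`.
    have h5 : ∫ ω, (Z ω * Q ω - z * Q ω) ∂P ≤ ∫ ω, (Z ω * Q₀ ω - z * Q₀ ω) ∂P := by
      refine integral_mono_ae (h1.sub (h3.const_mul z)) (h2.sub (h4.const_mul z)) ?_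
      filter_upwards [hQ.2.1] with ω hω
      by_cases h : Z ω ∈ Set.Ioi z
      · have : z < Z ω := h
        simp only [hQ₀, h, Set.indicator_of_mem]
        nlinarith [hω.2]
      · have : Z ω ≤ z := not_lt.1 h
        simp only [hQ₀, h, not_false_eq_true, Set.indicator_of_notMem]
        nlinarith [hω.1]
    rw [integral_sub h1 (h3.const_mul z), integral_sub h2 (h4.const_mul z), integral_const_mul,
      integral_const_mul, hQ.2.2, hQ₀m.2.2, hZQ₀] at h5
    linarith
  have hCQ : ∀ Q ∈ scvarEnvelope P q,
      ∫ ω, C ω * Q ω ∂P = q * m + s * ∫ ω, Z ω * Q ω ∂P := by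
    intro Q hQ
    have h1 : ∫ ω, C ω * Q ω ∂P = ∫ ω, (m * Q ω + s * (Z ω * Q ω)) ∂P := by
      refine integral_congr_ae ?_
      filter_upwards [hC] with ω hω
      rw [hω]; ring
    rw [h1, integral_add ((integrable_of_mem_scvarEnvelope hQ).const_mul m)
      ((integrable_mul_of_mem_scvarEnvelope hZi hQ).const_mul s), integral_const_mul,
      integral_const_mul, hQ.2.2, mul_comm m q]
  refine IsGreatest.csSup_eq ⟨⟨Q₀, hQ₀m, ?_⟩, ?_⟩
  · change ∫ ω, C ω * Q₀ ω ∂P = _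
    rw [hCQ _ hQ₀m, hZQ₀]
  · rintro _ ⟨Q, hQ, rfl⟩
    change ∫ ω, C ω * Q ω ∂P ≤ _
    rw [hCQ _ hQ]
    gcongr
    exact hZQ Q hQ

/-- The scaled conditional value-at-risk of a normal random variable. The standard normal random
variable `Z` is only needed to exist. -/
lemma scvar_eq_of_map_eq_gaussianReal [IsProbabilityMeasure P] {q : ℝ} (hq : q ∈ Set.Ioo (0 : ℝ) 1) {m : ℝ} {v : ℝ≥0}
    {Z C : Ω → ℝ} (hZ : HasLaw Z (gaussianReal 0 1) P) (hCm : AEMeasurable C P)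
    (hC : P.map C = gaussianReal m v) : scvar P q C = q * m + √v * kappa q := by
  -- A constant cannot be standardized, so the degenerate case uses the auxiliary `Z` with
  -- coefficient zero.
  by_cases hv : v = 0
  · subst hv
    rw [gaussianReal_zero_var] at hC
    refine scvar_eq_of_hasLaw hq (Real.sqrt_nonneg _) hZ ?_
    filter_upwards [HasLaw.ae_eq_of_dirac ⟨hCm, hC⟩] with ω hω
    simpa using hω
  · have hs : √(v : ℝ) ≠ 0 := (Real.sqrt_pos.2 (NNReal.coe_pos.2 (pos_iff_ne_zero.2 hv))).ne'
    have h1 := gaussianReal_div_const (gaussianReal_sub_const ⟨hCm, hC⟩ m) (√(v : ℝ))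
    have h2 : gaussianReal ((m - m) / √(v : ℝ)) (v / .mk (√(v : ℝ) ^ 2) (sq_nonneg _))
        = gaussianReal 0 1 := by
      rw [sub_self, zero_div]
      congr 1
      ext
      simp [Real.sq_sqrt, hv]
    rw [h2] at h1
    refine scvar_eq_of_hasLaw hq (Real.sqrt_nonneg _) h1 (Eventually.of_forall fun ω => ?_)
    field_simp
    ring

end

/-- Multiplication by `q` maps one envelope bijectively onto the other; hence both criteria have the
same minimizers. -/
lemma cvar_eq_inv_mul_scvar (P : Measure Ω) {q : ℝ} (hq : 0 < q) (C : Ω → ℝ) :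
    cvar P q C = q⁻¹ * scvar P q C := by
  rw [cvar, scvar, ← smul_eq_mul, ← Real.sSup_smul_of_nonneg (inv_nonneg.2 hq.le)]
  congr 1
  ext y
  simp only [Set.mem_image, Set.mem_smul_set]
  constructor
  · rintro ⟨Q, ⟨h1, h2, h3⟩, rfl⟩
    refine ⟨_, ⟨fun ω => q * Q ω, ⟨h1.const_mul q, ?_, ?_⟩, rfl⟩, ?_⟩
    · filter_upwards [h2] with ω hω
      refine ⟨mul_nonneg hq.le hω.1, ?_⟩
      have := mul_le_mul_of_nonneg_left hω.2 hq.le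
      rwa [mul_one_div_cancel hq.ne'] at this
    · rw [integral_const_mul, h3, mul_one]
    · simp only [mul_left_comm _ q, integral_const_mul, smul_eq_mul]
      rw [mul_inv_cancel_left₀ hq.ne']
  · rintro ⟨_, ⟨Q, ⟨h1, h2, h3⟩, rfl⟩, rfl⟩
    refine ⟨fun ω => q⁻¹ * Q ω, ⟨h1.const_mul _, ?_, ?_⟩, ?_⟩
    · filter_upwards [h2] with ω hω
      refine ⟨mul_nonneg (inv_nonneg.2 hq.le) hω.1, ?_⟩
      have := mul_le_mul_of_nonneg_left hω.2 (inv_nonneg.2 hq.le)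
      rw [mul_one] at this
      rwa [one_div]
    · rw [integral_const_mul, h3, inv_mul_cancel₀ hq.ne']
    · simp only [mul_left_comm _ q⁻¹, integral_const_mul, smul_eq_mul]

/-! ### Energy identities for deterministic policies -/

namespace IsDeterministicPolicy

variable {M x : ℝ} {π : ℝ → ℝ}

/-- This is `(X²)' = -2 X π` integrated. The derivative exists only almost everywhere, hence
integration by parts for absolutely continuous functions. -/
lemma intervalIntegral_position_mul_rate (h : IsDeterministicPolicy M x π) {T : ℝ} (hT : 0 ≤ T) :
    ∫ t in (0 : ℝ)..T, position x π t * π t = (x ^ 2 - position x π T ^ 2) / 2 := by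
  set p := (Set.Ici 0).indicator π with hp
  have hpi : ∀ a b, IntervalIntegrable p volume a b := h.intervalIntegrable_indicator_rate
  set g : ℝ → ℝ := fun t => ∫ s in (0 : ℝ)..t, p s with hg
  have hgc : Continuous g := intervalIntegral.continuous_primitive hpi 0
  have hac : AbsolutelyContinuousOnInterval g 0 T :=
    (hpi 0 T).absolutelyContinuousOnInterval_intervalIntegral (by simp)
  have hderiv : ∀ᵐ t, t ∈ Set.uIoc 0 T → deriv g t = p t := by
    filter_upwards [(hpi 0 T).ae_hasDerivAt_integral] with t ht htT
    exact (ht (Set.uIoc_subset_uIcc htT) 0 (by simp)).deriv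
  have h1 := hac.integral_mul_deriv_eq_deriv_mul hac
  have h2 : ∫ t in (0 : ℝ)..T, g t * deriv g t = ∫ t in (0 : ℝ)..T, g t * p t := by
    refine intervalIntegral.integral_congr_ae ?_
    filter_upwards [hderiv] with t ht htT
    rw [ht htT]
  have h3 : ∫ t in (0 : ℝ)..T, deriv g t * g t = ∫ t in (0 : ℝ)..T, g t * p t := by
    refine intervalIntegral.integral_congr_ae ?_
    filter_upwards [hderiv] with t ht htT
    rw [ht htT, mul_comm]
  have hg0 : g 0 = 0 := by simp [hg]
  rw [h2, h3, hg0] at h1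
  have h4 : ∫ t in (0 : ℝ)..T, position x π t * π t
      = ∫ t in (0 : ℝ)..T, (x * p t - g t * p t) := by
    refine intervalIntegral.integral_congr fun t ht => ?_
    rw [Set.uIcc_of_le hT] at ht
    have hpt : p t = π t := Set.indicator_of_mem (show t ∈ Set.Ici 0 from ht.1) _
    rw [← position_indicator_rate x π ht.1, ← hpt]
    exact sub_mul x (g t) (p t)
  rw [h4, intervalIntegral.integral_sub ((hpi 0 T).const_mul x)
    ((hpi 0 T).continuousOn_mul hgc.continuousOn), intervalIntegral.integral_const_mul,
    ← position_indicator_rate x π hT, position]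
  change x * g T - _ = (x ^ 2 - (x - g T) ^ 2) / 2
  linarith

lemma integrable_position_mul_rate (h : IsDeterministicPolicy M x π) :
    IntegrableOn (fun t => position x π t * π t) (Set.Ici 0) :=
  h.memLp_position.integrable_mul h.memLp_rate

/-- The limit of `X_T²` exists because `X π` is integrable, and it is zero because `X²` is
integrable on a half-line of infinite measure. -/
lemma integral_position_mul_rate (h : IsDeterministicPolicy M x π) :
    ∫ t in Set.Ici (0 : ℝ), position x π t * π t = x ^ 2 / 2 := by
  rw [integral_Ici_eq_integral_Ioi]
  set L := ∫ t in Set.Ioi (0 : ℝ), position x π t * π t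
  have h1 : Tendsto (fun T => ∫ t in (0 : ℝ)..T, position x π t * π t) atTop (𝓝 L) :=
    intervalIntegral_tendsto_integral_Ioi 0
      (h.integrable_position_mul_rate.mono_set Set.Ioi_subset_Ici_self) tendsto_id
  have h2 : Tendsto (fun T => position x π T ^ 2) atTop (𝓝 (x ^ 2 - 2 * L)) := by
    refine (tendsto_const_nhds.sub (h1.const_mul 2)).congr' ?_
    filter_upwards [eventually_ge_atTop 0] with T hT
    rw [h.intervalIntegral_position_mul_rate hT]
    ring
  have h3 : IntegrableAtFilter (fun T => position x π T ^ 2) atTop volume :=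
    ⟨Set.Ici 0, Ici_mem_atTop 0, h.position_sq_integrable⟩
  have h4 := h3.eq_zero_of_tendsto (fun s hs => by
    obtain ⟨a, ha⟩ := mem_atTop_sets.1 hs
    exact measure_mono_top (fun b hb => ha b hb) (Real.volume_Ici (a := a))) h2
  linarith

/-- The squared distance of the rate from a multiple of the position. -/
lemma integral_sub_mul_position_sq (h : IsDeterministicPolicy M x π) (r : ℝ) :
    ∫ t in Set.Ici (0 : ℝ), (π t - r * position x π t) ^ 2
      = (∫ t in Set.Ici (0 : ℝ), π t ^ 2) - r * x ^ 2
        + r ^ 2 * ∫ t in Set.Ici (0 : ℝ), position x π t ^ 2 := by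
  have h1 : ∀ t, (π t - r * position x π t) ^ 2
      = π t ^ 2 - 2 * r * (position x π t * π t) + r ^ 2 * position x π t ^ 2 :=
    fun t => by ring
  simp_rw [h1]
  rw [integral_add, integral_sub, integral_const_mul, integral_const_mul,
    h.integral_position_mul_rate]
  · ring
  · exact h.rate_sq_integrable
  · exact h.integrable_position_mul_rate.const_mul _
  · exact h.rate_sq_integrable.sub (h.integrable_position_mul_rate.const_mul _)
  · exact h.position_sq_integrable.const_mul _

/-- Cauchy–Schwarz for `∫ X π = x² / 2`, as the discriminant of the nonnegative quadratic `r ↦ ∫ (π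
- r X)²`. -/
lemma pow_four_le (h : IsDeterministicPolicy M x π) :
    x ^ 4 ≤ 4 * (∫ t in Set.Ici (0 : ℝ), π t ^ 2)
      * ∫ t in Set.Ici (0 : ℝ), position x π t ^ 2 := by
  have := discrim_le_zero (a := ∫ t in Set.Ici (0 : ℝ), position x π t ^ 2) (b := -x ^ 2)
    (c := ∫ t in Set.Ici (0 : ℝ), π t ^ 2) fun r => by
      have h1 := h.integral_sub_mul_position_sq r
      have h2 : 0 ≤ ∫ t in Set.Ici (0 : ℝ), (π t - r * position x π t) ^ 2 :=
        integral_nonneg fun _ => sq_nonneg _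
      linarith
  rw [discrim] at this
  linarith

/-- If the rate is `r` times the position, then the position decays exponentially. -/
lemma position_eq_of_integral_eq_zero (h : IsDeterministicPolicy M x π) {r : ℝ}
    (h0 : ∫ t in Set.Ici (0 : ℝ), (π t - r * position x π t) ^ 2 = 0) {t : ℝ} (ht : 0 ≤ t) :
    position x π t = x * Real.exp (-(r * t)) := by
  have hint : IntegrableOn (fun t => (π t - r * position x π t) ^ 2) (Set.Ici 0) :=
    (h.memLp_rate.sub (h.memLp_position.const_mul r)).integrable_sq
  rw [integral_eq_zero_iff_of_nonneg (fun _ => sq_nonneg _) hint] at h0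
  set X := position x ((Set.Ici 0).indicator π) with hX
  have hXc : Continuous X := h.continuous_position_indicator_rate
  -- `Y` agrees with `X` for `t ≥ 0` and is differentiable everywhere, so `Y e^{rt}` can be shown
  -- constant by differentiation.
  set Y : ℝ → ℝ := fun t => x - ∫ s in (0 : ℝ)..t, r * X s with hY
  have hYd : ∀ t, HasDerivAt Y (-(r * X t)) t := fun t =>
    ((continuous_const.mul hXc).integral_hasStrictDerivAt 0 t).hasDerivAt.const_sub x
  have hXY : ∀ t, 0 ≤ t → X t = Y t := by
    intro t ht
    rw [hX, position_indicator_rate x π ht, position]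
    simp only [hY]
    congr 1
    refine intervalIntegral.integral_congr_ae ?_
    rw [Filter.EventuallyEq, ae_restrict_iff' measurableSet_Ici] at h0
    filter_upwards [h0] with s hs hst
    rw [Set.uIoc_of_le ht] at hst
    have hs' := hs hst.1.le
    rw [hX, position_indicator_rate x π hst.1.le]
    exact sub_eq_zero.1 (pow_eq_zero_iff two_ne_zero |>.1 hs')
  have hexp : ∀ t, HasDerivAt (fun t => Real.exp (r * t)) (Real.exp (r * t) * r) t := fun t => by
    simpa using ((hasDerivAt_id t).const_mul r).exp
  have hconst := constant_of_has_deriv_right_zero (f := fun t => Y t * Real.exp (r * t))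
    (a := 0) (b := t)
    (fun s _ => ((hYd s).mul (hexp s)).continuousAt.continuousWithinAt)
    (fun s hs => by
      have := ((hYd s).mul (hexp s)).hasDerivWithinAt (s := Set.Ici s)
      refine this.congr_deriv ?_
      rw [hXY s hs.1]
      ring) t ⟨ht, le_rfl⟩
  simp only [mul_zero, Real.exp_zero, mul_one] at hconst
  have hY0 : Y 0 = x := by simp [hY]
  rw [← position_indicator_rate x π ht, ← hX, hXY t ht, Real.exp_neg, ← hY0, ← hconst]
  field_simp

end IsDeterministicPolicy

/-! ### The exponential schedule -/

section

variable {x τ : ℝ}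

lemma position_expPolicy (x τ t : ℝ) :
    position x (expPolicy x τ) t = x * Real.exp (-t / τ) := by
  have hd : ∀ s, HasDerivAt (fun s => -(x * Real.exp (-s / τ))) (expPolicy x τ s) s := fun s => by
    have h1 : HasDerivAt (fun s : ℝ => -s / τ) (-1 / τ) s := (hasDerivAt_id s).fun_neg.div_const τ
    refine ((h1.exp.const_mul x).fun_neg).congr_deriv ?_
    rw [expPolicy]
    ring
  have hc : Continuous (expPolicy x τ) := by unfold expPolicy; fun_prop
  rw [position, intervalIntegral.integral_eq_sub_of_hasDerivAt (fun s _ => hd s)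
    (hc.intervalIntegrable _ _)]
  simp

lemma integrableOn_exp_sq (hτ : 0 < τ) (c : ℝ) :
    IntegrableOn (fun t => (c * Real.exp (-t / τ)) ^ 2) (Set.Ici 0) := by
  have h1 : ∀ t, (c * Real.exp (-t / τ)) ^ 2 = c ^ 2 * Real.exp (-(2 / τ) * t) := fun t => by
    rw [mul_pow, ← Real.exp_nat_mul]
    congr 2
    push_cast
    ring
  simp_rw [h1]
  rw [integrableOn_Ici_iff_integrableOn_Ioi]
  exact (exp_neg_integrableOn_Ioi 0 (by positivity)).const_mul _

lemma isDeterministicPolicy_expPolicy {M : ℝ} (hτ : 0 < τ) (hx : |x| ≤ M) :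
    IsDeterministicPolicy M x (expPolicy x τ) where
  measurable := by
    have hc : Continuous (expPolicy x τ) := by unfold expPolicy; fun_prop
    exact hc.measurable.comp measurable_subtype_coe
  rate_sq_integrable := integrableOn_exp_sq hτ (x / τ)
  position_sq_integrable := by
    simp_rw [position_expPolicy]
    exact integrableOn_exp_sq hτ x
  position_mem t ht := by
    rw [position_expPolicy, Set.mem_Icc, ← abs_le, abs_mul, Real.abs_exp]
    refine (mul_le_of_le_one_right (abs_nonneg x) (Real.exp_le_one_iff.2 ?_)).trans hx
    rw [neg_div, neg_nonpos]
    positivity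

/-- Here `π = X / τ`, so the energy identity with `r = 1 / τ` has left side zero and determines both
integrals. -/
lemma integral_expPolicy_sq {M : ℝ} (hτ : 0 < τ) (hx : |x| ≤ M) :
    ∫ t in Set.Ici (0 : ℝ), expPolicy x τ t ^ 2 = x ^ 2 / (2 * τ) ∧
      ∫ t in Set.Ici (0 : ℝ), position x (expPolicy x τ) t ^ 2 = x ^ 2 * τ / 2 := by
  have hrate : ∀ t, expPolicy x τ t = τ⁻¹ * position x (expPolicy x τ) t := fun t => by
    rw [position_expPolicy, expPolicy]
    ring
  have h1 := (isDeterministicPolicy_expPolicy hτ hx).integral_sub_mul_position_sq τ⁻¹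
  have h2 : ∫ t in Set.Ici (0 : ℝ), expPolicy x τ t ^ 2
      = (τ⁻¹) ^ 2 * ∫ t in Set.Ici (0 : ℝ), position x (expPolicy x τ) t ^ 2 := by
    rw [← integral_const_mul]
    refine integral_congr_ae (Eventually.of_forall fun t => ?_)
    simp only
    rw [hrate t, mul_pow]
  have h3 : ∀ t, expPolicy x τ t - τ⁻¹ * position x (expPolicy x τ) t = 0 := fun t =>
    sub_eq_zero.2 (hrate t)
  simp_rw [h3] at h1
  rw [h2] at h1 ⊢
  set B := ∫ t in Set.Ici (0 : ℝ), position x (expPolicy x τ) t ^ 2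
  have hB : B = x ^ 2 * τ / 2 := by
    simp only [ne_eq, OfNat.ofNat_ne_zero, not_false_eq_true, zero_pow, integral_zero] at h1
    field_simp at h1
    linarith
  refine ⟨?_, hB⟩
  rw [hB]
  field_simp

end

/-! ### The optimal time scale -/

/-- The parameter `c = √τ*` replaces fractional powers by polynomial relations. -/
lemma exists_tauStar_eq_sq {η σ x q : ℝ} (hη : 0 < η) (hσ : 0 < σ) (hx : x ≠ 0) (hq : 0 < q) :
    ∃ c > 0, tauStar η σ x q = c ^ 2 ∧ √2 * σ * kappa q * c ^ 3 = η * |x| * q := by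
  have hκ := kappa_pos q
  have hx' := abs_pos.2 hx
  set w := η * |x| * q / (√2 * σ * kappa q) with hw
  have hw0 : 0 < w := by positivity
  refine ⟨w ^ (1 / 3 : ℝ), by positivity, ?_, ?_⟩
  · rw [tauStar, ← hw, ← Real.rpow_natCast, ← Real.rpow_mul hw0.le]
    norm_num
  · rw [← Real.rpow_natCast, ← Real.rpow_mul hw0.le]
    norm_num
    rw [hw]
    field_simp

/-- The minimum of `α A + β √B` under the constraint `x⁴ ≤ 4 A B`, and the point where it is
attained. -/
lemma min_energy {α β x b₀ A B : ℝ} (hα : 0 < α) (hβ : 0 < β) (hx : x ≠ 0)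
    (hb₀ : 0 < b₀) (hopt : β * b₀ ^ 3 = α * x ^ 4 / 2) (hB : 0 ≤ B)
    (hAB : x ^ 4 ≤ 4 * A * B) :
    3 / 2 * β * b₀ ≤ α * A + β * √B ∧
      (α * A + β * √B = 3 / 2 * β * b₀ → B = b₀ ^ 2 ∧ A = x ^ 4 / (4 * b₀ ^ 2)) := by
  have hx4 : 0 < x ^ 4 := by positivity
  have hBpos : 0 < B := by
    refine lt_of_le_of_ne hB fun h => ?_
    rw [← h, mul_zero] at hAB
    linarith
  set b := √B with hb
  have hbpos : 0 < b := Real.sqrt_pos.2 hBpos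
  have hbB : B = b ^ 2 := (Real.sq_sqrt hB).symm
  rw [hbB] at hAB ⊢
  have h1 : α * x ^ 4 ≤ α * (4 * A * b ^ 2) := mul_le_mul_of_nonneg_left hAB hα.le
  -- The excess is the Cauchy–Schwarz defect plus `2 b³ - 3 b₀ b² + b₀³ = (b - b₀)² (2 b + b₀)`, up
  -- to positive factors; both vanish at a minimum.
  have h2 : (α * A + β * b - 3 / 2 * β * b₀) * (2 * b ^ 2)
      = (α * (4 * A * b ^ 2) - α * x ^ 4) / 2 + β * ((b - b₀) ^ 2 * (2 * b + b₀)) := by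
    linear_combination -hopt
  have h3 : 0 ≤ β * ((b - b₀) ^ 2 * (2 * b + b₀)) := by positivity
  refine ⟨?_, fun heq => ?_⟩
  · have : 0 ≤ α * A + β * b - 3 / 2 * β * b₀ := by
      refine nonneg_of_mul_nonneg_left (b := 2 * b ^ 2) ?_ (by positivity)
      rw [h2]
      linarith
    linarith
  · rw [heq, sub_self, zero_mul] at h2
    have h4 : β * ((b - b₀) ^ 2 * (2 * b + b₀)) = 0 := by linarith
    have h5 : b = b₀ := by
      have h6 : (b - b₀) ^ 2 = 0 := by
        rcases mul_eq_zero.1 ((mul_eq_zero.1 h4).resolve_left hβ.ne') with h | h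
        · exact h
        · linarith
      exact sub_eq_zero.1 (pow_eq_zero_iff two_ne_zero |>.1 h6)
    refine ⟨by rw [h5], ?_⟩
    rw [← h5]
    have h7 : α * (4 * A * b ^ 2) = α * x ^ 4 := by linarith
    rw [eq_div_iff (by positivity)]
    linarith [mul_left_cancel₀ hα.ne' h7]

/-- The scaled conditional value-at-risk of the total cost of a deterministic policy. -/
lemma scvar_totalCost {P : Measure Ω} [IsProbabilityMeasure P] {W : ℝ≥0 → Ω → ℝ}
    (hW : IsPreBrownianReal W P) {η σ M x q : ℝ} (hσ : 0 < σ) (hq : q ∈ Set.Ioo (0 : ℝ) 1)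
    {π : ℝ → ℝ} (h : IsDeterministicPolicy M x π) :
    scvar P q (totalCost P W η σ x π)
      = q * η / 2 * (∫ t in Set.Ici (0 : ℝ), π t ^ 2)
        + σ * kappa q * √(∫ t in Set.Ici (0 : ℝ), position x π t ^ 2) := by
  have hB : 0 ≤ ∫ t in Set.Ici (0 : ℝ), position x π t ^ 2 :=
    integral_nonneg fun _ => sq_nonneg _
  -- The auxiliary standard normal variable is `W 1`.
  rw [scvar_eq_of_map_eq_gaussianReal hq (hW.hasLaw_eval 1)
    (isTotalCost_totalCost hW h).1.1.aemeasurable (map_totalCost hW h),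
    Real.coe_toNNReal _ (by positivity), Real.sqrt_mul (sq_nonneg σ), Real.sqrt_sq hσ.le]
  ring

/-! ### Optimality of the exponential schedule. -/

section

variable {η σ M x q : ℝ}

lemma isDeterministicPolicy_expPolicy_tauStar (hη : 0 < η) (hσ : 0 < σ) (hx : |x| ≤ M)
    (hq : 0 < q) : IsDeterministicPolicy M x (expPolicy x (tauStar η σ x q)) := by
  by_cases hx0 : x = 0
  · subst hx0
    have h0 : expPolicy 0 (tauStar η σ 0 q) = fun _ => 0 := by ext t; simp [expPolicy]
    have hp : ∀ t, position 0 (fun _ => (0 : ℝ)) t = 0 := fun t => by simp [position]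
    rw [h0]
    refine ⟨measurable_const, by simp, by simp [hp], fun t _ => ?_⟩
    rw [hp, Set.mem_Icc, ← abs_le]
    exact hx
  · obtain ⟨c, hc, hτ, -⟩ := exists_tauStar_eq_sq hη hσ hx0 hq
    rw [hτ]
    exact isDeterministicPolicy_expPolicy (by positivity) hx

/-- Both sides are nonnegative, and cubing them reduces the claim to a multiple of `hopt`. -/
lemma optimal_value_eq (hη : 0 < η) (hσ : 0 < σ) (hq : 0 < q) {y b : ℝ} (hy : 0 ≤ y)
    (hb : 0 ≤ b) (hopt : σ * kappa q * b ^ 3 = q * η / 2 * y ^ 4 / 2) :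
    3 / 2 * (σ * kappa q) * b = 3 / 2 ^ (5 / 3 : ℝ) * σ ^ (2 / 3 : ℝ) * η ^ (1 / 3 : ℝ)
      * y ^ (4 / 3 : ℝ) * q ^ (1 / 3 : ℝ) * kappa q ^ (2 / 3 : ℝ) := by
  have hκ := kappa_pos q
  have hcube : ∀ z : ℝ, 0 ≤ z → ∀ p : ℝ, (z ^ p) ^ 3 = z ^ (p * 3) := fun z hz p => by
    rw [Real.rpow_mul hz, ← Real.rpow_natCast]
    norm_num
  refine (pow_left_inj₀ (by positivity) (by positivity) three_ne_zero).1 ?_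
  simp only [mul_pow, div_pow]
  rw [hcube 2 (by norm_num), hcube σ hσ.le, hcube η hη.le, hcube y hy, hcube q hq.le,
    hcube _ hκ.le]
  norm_num
  linear_combination 27 / 8 * σ ^ 2 * kappa q ^ 2 * hopt

/-- The cost functional of deterministic policies is minimized by the exponential schedule, and
minimizers have rates proportional to their positions. -/
lemma energy_expPolicy_tauStar (hη : 0 < η) (hσ : 0 < σ) (hx : |x| ≤ M) (hq : 0 < q) :
    q * η / 2 * (∫ t in Set.Ici (0 : ℝ), expPolicy x (tauStar η σ x q) t ^ 2)
        + σ * kappa q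
          * √(∫ t in Set.Ici (0 : ℝ), position x (expPolicy x (tauStar η σ x q)) t ^ 2)
      = 3 / 2 ^ (5 / 3 : ℝ) * σ ^ (2 / 3 : ℝ) * η ^ (1 / 3 : ℝ) * |x| ^ (4 / 3 : ℝ)
        * q ^ (1 / 3 : ℝ) * kappa q ^ (2 / 3 : ℝ) ∧
    ∀ π, IsDeterministicPolicy M x π →
      3 / 2 ^ (5 / 3 : ℝ) * σ ^ (2 / 3 : ℝ) * η ^ (1 / 3 : ℝ) * |x| ^ (4 / 3 : ℝ)
          * q ^ (1 / 3 : ℝ) * kappa q ^ (2 / 3 : ℝ)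
        ≤ q * η / 2 * (∫ t in Set.Ici (0 : ℝ), π t ^ 2)
          + σ * kappa q * √(∫ t in Set.Ici (0 : ℝ), position x π t ^ 2) ∧
      (q * η / 2 * (∫ t in Set.Ici (0 : ℝ), π t ^ 2)
          + σ * kappa q * √(∫ t in Set.Ici (0 : ℝ), position x π t ^ 2)
        = 3 / 2 ^ (5 / 3 : ℝ) * σ ^ (2 / 3 : ℝ) * η ^ (1 / 3 : ℝ) * |x| ^ (4 / 3 : ℝ)
          * q ^ (1 / 3 : ℝ) * kappa q ^ (2 / 3 : ℝ) →
        ∫ t in Set.Ici (0 : ℝ), (π t - (tauStar η σ x q)⁻¹ * position x π t) ^ 2 = 0) := by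
  have hκ := kappa_pos q
  have hA : ∀ π : ℝ → ℝ, 0 ≤ ∫ t in Set.Ici (0 : ℝ), π t ^ 2 :=
    fun π => integral_nonneg fun _ => sq_nonneg _
  by_cases hx0 : x = 0
  · subst hx0
    have hval : 3 / 2 ^ (5 / 3 : ℝ) * σ ^ (2 / 3 : ℝ) * η ^ (1 / 3 : ℝ) * |0| ^ (4 / 3 : ℝ)
        * q ^ (1 / 3 : ℝ) * kappa q ^ (2 / 3 : ℝ) = 0 := by
      rw [abs_zero, Real.zero_rpow (by norm_num)]
      ring
    -- With `0⁻¹ = 0`, the equality case for `x = 0` reads `∫ π² = 0`.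
    have hτ : tauStar η σ 0 q = 0 := by
      rw [tauStar, abs_zero, mul_zero, zero_mul, zero_div, Real.zero_rpow (by norm_num)]
    rw [hval]
    refine ⟨by simp [expPolicy, position], fun π _ => ⟨?_, fun h => ?_⟩⟩
    · have := hA π
      positivity
    · have h1 := mul_nonneg (show 0 ≤ q * η / 2 by positivity) (hA π)
      have h2 : 0 ≤ σ * kappa q * √(∫ t in Set.Ici (0 : ℝ), position 0 π t ^ 2) := by positivity
      have h3 : q * η / 2 * (∫ t in Set.Ici (0 : ℝ), π t ^ 2) = 0 := by linarith
      simpa [hτ] using (mul_eq_zero.1 h3).resolve_left (by positivity)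
  obtain ⟨c, hc, hτ, hc3⟩ := exists_tauStar_eq_sq hη hσ hx0 hq
  have hx' := abs_pos.2 hx0
  have hsqrt2 : √2 ^ 2 = (2 : ℝ) := Real.sq_sqrt zero_le_two
  have hsqrt2pos : 0 < √(2 : ℝ) := by positivity
  -- This is `√B` for the exponential schedule, where `B = x² τ* / 2`; `hopt'` identifies it as the
  -- critical point.
  set b := |x| * c / √2 with hb
  have hbpos : 0 < b := by positivity
  have hb2 : b ^ 2 = x ^ 2 * c ^ 2 / 2 := by rw [hb, div_pow, mul_pow, sq_abs, hsqrt2]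
  have hopt' : σ * kappa q * b ^ 3 = q * η / 2 * |x| ^ 4 / 2 := by
    have h4 : √2 ^ 4 = (4 : ℝ) := by rw [show 4 = 2 * 2 from rfl, pow_mul, hsqrt2]; norm_num
    rw [hb, div_pow, mul_pow]
    field_simp
    linear_combination √2 ^ 3 * hc3 - σ * kappa q * c ^ 3 * h4
  have hopt : σ * kappa q * b ^ 3 = q * η / 2 * x ^ 4 / 2 := by
    rw [hopt', Even.pow_abs (by decide)]
  rw [← optimal_value_eq hη hσ hq hx'.le hbpos.le hopt', hτ]
  refine ⟨?_, fun π h => ?_⟩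
  · obtain ⟨h1, h2⟩ := integral_expPolicy_sq (τ := c ^ 2) (by positivity) hx
    rw [h1, h2, ← hb2, Real.sqrt_sq hbpos.le]
    have h3 : q * η / 2 * (x ^ 2 / (2 * c ^ 2)) = σ * kappa q * b / 2 := by
      have h4 : σ * kappa q * b * b ^ 2 = q * η / 2 * x ^ 4 / 2 := by rw [← hopt]; ring
      rw [hb2] at h4
      field_simp at h4 ⊢
      linarith
    rw [h3]
    ring
  · obtain ⟨h1, h2⟩ := min_energy (α := q * η / 2) (β := σ * kappa q) (by positivity)
      (by positivity) hx0 hbpos hopt (integral_nonneg fun _ => sq_nonneg _) h.pow_four_le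
    refine ⟨h1, fun heq => ?_⟩
    obtain ⟨h3, h4⟩ := h2 heq
    -- The three terms are `x² / (2 τ*)`, `-x² / τ*` and `x² / (2 τ*)`.
    rw [h.integral_sub_mul_position_sq, h3, h4, hb2]
    field_simp
    ring

end

end OptimalExecution

theorem proposition5p1 {Ω : Type*} [MeasurableSpace Ω] (P : Measure Ω) [IsProbabilityMeasure P]
    (W : ℝ≥0 → Ω → ℝ) (hW : IsBrownianReal W P)
    (η σ M x q : ℝ) (hη : 0 < η) (hσ : 0 < σ) (hx : |x| ≤ M) (hq : q ∈ Set.Ioo (0 : ℝ) 1) :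
    -- the total cost of every admissible deterministic policy exists and is almost surely unique
    (∀ π ∈ deterministicPolicies M x, IsTotalCost P W η σ x π (totalCost P W η σ x π) ∧
      ∀ C, IsTotalCost P W η σ x π C → C =ᵐ[P] totalCost P W η σ x π) ∧
    -- the exponential schedule is admissible and optimal
    expPolicy x (tauStar η σ x q) ∈ deterministicPolicies M x ∧
    (∀ t, 0 ≤ t → position x (expPolicy x (tauStar η σ x q)) t
      = x * Real.exp (-t / tauStar η σ x q)) ∧
    IsMinOn (fun π => cvar P q (totalCost P W η σ x π)) (deterministicPolicies M x)
      (expPolicy x (tauStar η σ x q)) ∧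
    IsMinOn (fun π => scvar P q (totalCost P W η σ x π)) (deterministicPolicies M x)
      (expPolicy x (tauStar η σ x q)) ∧
    -- it is the only optimal schedule
    (∀ π ∈ deterministicPolicies M x,
      IsMinOn (fun π' => cvar P q (totalCost P W η σ x π')) (deterministicPolicies M x) π →
      ∀ t, 0 ≤ t → position x π t = x * Real.exp (-t / tauStar η σ x q)) ∧
    -- its performance
    scvar P q (totalCost P W η σ x (expPolicy x (tauStar η σ x q)))
      = 3 / 2 ^ (5 / 3 : ℝ) * σ ^ (2 / 3 : ℝ) * η ^ (1 / 3 : ℝ) * |x| ^ (4 / 3 : ℝ)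
        * q ^ (1 / 3 : ℝ) * kappa q ^ (2 / 3 : ℝ) := by
  have hB := hW.toIsPreBrownianReal
  have hexp := isDeterministicPolicy_expPolicy_tauStar hη hσ hx hq.1
  obtain ⟨hval, hmin⟩ := energy_expPolicy_tauStar hη hσ hx hq.1
  have hle : ∀ π ∈ deterministicPolicies M x,
      scvar P q (totalCost P W η σ x (expPolicy x (tauStar η σ x q)))
        ≤ scvar P q (totalCost P W η σ x π) := fun π hπ => by
    rw [scvar_totalCost hB hσ hq hexp, scvar_totalCost hB hσ hq hπ, hval]
    exact (hmin π hπ).1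
  have hq' : 0 < q⁻¹ := inv_pos.2 hq.1
  refine ⟨fun π hπ => ⟨isTotalCost_totalCost hB hπ, fun C hC => hC.ae_eq_totalCost hB hπ⟩, hexp,
    fun t _ => position_expPolicy x _ t, fun π hπ => ?_, hle, fun π hπ hopt t ht => ?_, ?_⟩
  · simp only [Set.mem_ofPred_eq, cvar_eq_inv_mul_scvar P hq.1]
    exact mul_le_mul_of_nonneg_left (hle π hπ) hq'.le
  · have h1 := hopt hexp
    simp only [Set.mem_ofPred_eq, cvar_eq_inv_mul_scvar P hq.1] at h1
    -- Any minimizer attains the optimal value, so the equality case of the energy bound applies.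
    have h2 := le_antisymm (le_of_mul_le_mul_left h1 hq') (hle π hπ)
    rw [scvar_totalCost hB hσ hq hexp, scvar_totalCost hB hσ hq hπ, hval] at h2
    rw [IsDeterministicPolicy.position_eq_of_integral_eq_zero hπ ((hmin π hπ).2 h2) ht]
    congr 2
    rw [neg_div, div_eq_inv_mul]
  · rw [scvar_totalCost hB hσ hq hexp, hval]
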